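/- Let $0$ be the type of natural numbers, $\rho\to\tau$ the type of functionals from type $\rho$ to type $\tau$, $1=0\to0$ and $2=1\to0$. Kohlenbach's base theory $\mathsf{RCA}_0^\omega=\mathsf{E\text{-}PRA}^\omega+\mathsf{QF\text{-}AC}^{1,0}$ is the theory in classical many-sorted logic, with variables of all finite types, whose terms are built by application from variables, $0$, the successor $S$, the combinators $\Pi,\Sigma$ of all types and the recursor $R_0$ of type $0$; its prime formulas are equations of type $0$, and for $\tau=(\tau_1\to\dots\to\tau_k\to0)$ the formula $x=_\tau y$ abbreviates $\forall z_1\dots z_k\,(xz_1\dots z_k=_0yz_1\dots z_k)$. Its axioms are: the equality axioms for $=_0$; $Sx\neq0$ and $Sx=Sy\to x=y$; $\Pi xy=x$, $\Sigma xyz=xz(yz)$; $R_00yz=y$, $R_0(Sx)yz=z(R_0xyz)x$; extensionality $x=_\rho y\to\varphi(x)=_\tau\varphi(y)$ for $\varphi$ of any type $\rho\to\tau$; induction for quantifier-free formulas; and the axiom of choice $\forall f^1\exists n^0A(f,n)\to\exists F^{2}\forall f^1A(f,F(f))$ for quantifier-free $A$ (parameters of all types are allowed in the last two). Let $\Phi_e^A$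 be the partial function computed by the $e$-th oracle register machine with oracle $A^1$ (a Minsky machine with registers $r_0,r_1,\dots$ and the instructions: halt; increase $r_m$; decrease $r_m$, or jump if $r_m=0$; $r_n:=A(r_m)$; input and output are in $r_0$, and programs are coded by numbers through Cantor pairing); the relation $\Phi_{e,s}^A(x)=y$ (the machine has halted within $s$ steps on input $x$, with output $y$) is expressed by a conjunction of two equations between terms of the theory that simulate the machine by primitive recursion on $s$, and $\Phi_e^A(x)=y$ stands for $(\exists s^0)(\Phi_{e,s}^A(x)=y)$. Consider the formulas $$\mathsf{UDNR}(\Psi):\ (\forall A^1)(\forall e^0)\,\neg\big(\Phi_e^A(e)=\Psi(A)(e)\big)\qquad(\Psi\text{ of type }1\to1),$$ $$\mathsf{MU}(\mu):\ (\forall f^1)\big[(\exists n^0)\,f(n)=0\ \to\ f(\mu(f))=0\big]\qquad(\mu\text{ of type }2),$$ $$\mathsf{Ext}(\Xi,\Psi):\ (\forall k^0,f^1,g^1)\big[\overline f\,\Xi(f,g,k)=_0\overline g\,\Xi(f,g,k)\ \to\ \overline{\Psi(f)}\,k=_0\overline{\Psi(g)}\,k\big],$$ where $\Xi$ is of type $1\to1\to0\to0$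 and $\overline f\,n$ is the code of $\langle f(0),\dots,f(n-1)\rangle$; $\mathsf{Ext}(\Xi,\Psi)$ says that $\Xi$ is an extensionality functional for $\Psi$. Let $\mathsf{UDNR}$ be $(\exists\Psi^{1\to1})\,\mathsf{UDNR}(\Psi)$, let $(\mu^2)$ be $(\exists\mu^2)\,\mathsf{MU}(\mu)$, and let $(\exists^2)$ be $(\exists\varphi^2)(\forall g^1)\big[(\exists x^0)\,g(x)=0\leftrightarrow\varphi(g)=0\big]$. **Theorem.** $\mathsf{RCA}_0^\omega$ proves $\mathsf{UDNR}\leftrightarrow(\mu^2)$ and $\mathsf{UDNR}\leftrightarrow(\exists^2)$. Moreover, the first equivalence is explicit: there are closed terms $s$ (of type $2\to(1\to1)$) and $u$ (of type $(1\to1)\to(1\to1\to0\to0)\to2$) of the language of $\mathsf{RCA}_0^\omega$ such that $\mathsf{RCA}_0^\omega$ proves $$(\forall\mu^2)\big[\mathsf{MU}(\mu)\to\mathsf{UDNR}(s(\mu))\big]$$ and $$(\forall\Psi^{1\to1})(\forall\Xi^{1\to1\to0\to0})\big[\mathsf{UDNR}(\Psi)\wedge\mathsf{Ext}(\Xi,\Psi)\to\mathsf{MU}(u(\Psi,\Xi))\big].$$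 -/

import Mathlib

namespace HOArith

/-! ### Syntax of arithmetic in all finite types -/

/-- The finite types: `0` (natural numbers) and `ρ → τ`. -/
inductive Ty : Type
  | zero : Ty
  | arr : Ty → Ty → Ty

infixr:60 " ⇾ " => Ty.arr

/-- The type `0` of natural numbers. -/
abbrev N0 : Ty := Ty.zero
/-- The type `1 = 0 → 0`. -/
abbrev N1 : Ty := N0 ⇾ N0
/-- The type `2 = 1 → 0`. -/
abbrev N2 : Ty := N1 ⇾ N0

/-- A context: the list of the types of the free variables, most recently bound first. -/
abbrev Ctx : Type := List Ty

/-- Typed de Bruijn variables. -/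
inductive Var : Ctx → Ty → Type
  | here {Γ : Ctx} {σ : Ty} : Var (σ :: Γ) σ
  | there {Γ : Ctx} {σ τ : Ty} : Var Γ σ → Var (τ :: Γ) σ

/-- The constants: zero, successor, the combinators `Π` and `Σ` in all types, and the recursor
`R₀` of type `0`. -/
inductive Cst : Ty → Type
  | zero : Cst N0
  | succ : Cst N1
  | proj (ρ τ : Ty) : Cst (ρ ⇾ τ ⇾ ρ)
  | comb (δ ρ τ : Ty) : Cst ((δ ⇾ ρ ⇾ τ) ⇾ (δ ⇾ ρ) ⇾ δ ⇾ τ)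
  | recr : Cst (N0 ⇾ N0 ⇾ (N0 ⇾ N0 ⇾ N0) ⇾ N0)

/-- Terms with free variables in `Γ`. -/
inductive Tm (Γ : Ctx) : Ty → Type
  | var {τ : Ty} : Var Γ τ → Tm Γ τ
  | cst {τ : Ty} : Cst τ → Tm Γ τ
  | app {σ τ : Ty} : Tm Γ (σ ⇾ τ) → Tm Γ σ → Tm Γ τ

infixl:75 " ⬝ " => Tm.app

/-- Formulas with free variables in `Γ`; the only prime formulas are `⊥` and equations of
type `0`.  The logic is classical, so that the other connectives are abbreviations. -/
inductive Fm : Ctx → Type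
  | eq {Γ : Ctx} : Tm Γ N0 → Tm Γ N0 → Fm Γ
  | bot {Γ : Ctx} : Fm Γ
  | imp {Γ : Ctx} : Fm Γ → Fm Γ → Fm Γ
  | all {Γ : Ctx} (σ : Ty) : Fm (σ :: Γ) → Fm Γ

/-- Simultaneous substitutions. -/
abbrev Sub (Γ Δ : Ctx) : Type := ∀ τ : Ty, Var Γ τ → Tm Δ τ

namespace Tm

/-- Application of a simultaneous substitution. -/
def subst {Γ Δ : Ctx} (θ : Sub Γ Δ) : {τ : Ty} → Tm Γ τ → Tm Δ τ
  | _, .var x => θ _ x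
  | _, .cst c => .cst c
  | _, .app f a => .app (f.subst θ) (a.subst θ)

/-- Weakening by one fresh variable. -/
def wk {Γ : Ctx} {σ τ : Ty} (t : Tm Γ τ) : Tm (σ :: Γ) τ :=
  t.subst (fun _ x => .var (.there x))

/-- A closed term, viewed in an arbitrary context. -/
def emb {Γ : Ctx} {τ : Ty} (t : Tm [] τ) : Tm Γ τ :=
  t.subst (fun _ x => by cases x)

/-- The term itself, in the context without the last variable, provided that this variable does
not occur in it. -/
def strengthen {Γ : Ctx} {σ : Ty} : {τ : Ty} → Tm (σ :: Γ) τ → Option (Tm Γ τ)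
  | _, .var .here => none
  | _, .var (.there x) => some (.var x)
  | _, .cst c => some (.cst c)
  | _, .app f a =>
    match f.strengthen, a.strengthen with
    | some f', some a' => some (f' ⬝ a')
    | _, _ => none

/-- The abstraction `λx.t`, defined from the combinators: it is `Π t` if `x` does not occur in `t`,
otherwise `λx.x` is `Σ Π Π` and `λx.(f a)` is `Σ (λx.f) (λx.a)`. -/
def lam {Γ : Ctx} {σ : Ty} : {τ : Ty} → Tm (σ :: Γ) τ → Tm Γ (σ ⇾ τ)
  | _, .var .here => .cst (.comb σ (σ ⇾ σ) σ) ⬝ .cst (.proj σ (σ ⇾ σ)) ⬝ .cst (.proj σ σ)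
  | _, .var (.there x) => .cst (.proj _ σ) ⬝ .var x
  | _, .cst c => .cst (.proj _ σ) ⬝ .cst c
  | _, .app f a =>
    match (f ⬝ a).strengthen with
    | some t => .cst (.proj _ σ) ⬝ t
    | none => .cst (.comb σ _ _) ⬝ f.lam ⬝ a.lam

end Tm

section Variables
variable {Γ : Ctx} {a b c d : Ty}

/-- The variable bound last. -/
abbrev v0 : Tm (a :: Γ) a := .var .here
/-- The variable bound last but one. -/
abbrev v1 : Tm (b :: a :: Γ) a := .var (.there .here)
/-- The variable bound last but two. -/
abbrev v2 : Tm (c :: b :: a :: Γ) a := .var (.there (.there .here))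
/-- The variable bound last but three. -/
abbrev v3 : Tm (d :: c :: b :: a :: Γ) a := .var (.there (.there (.there .here)))
/-- The variable bound last but four. -/
abbrev v4 {e : Ty} : Tm (e :: d :: c :: b :: a :: Γ) a :=
  .var (.there (.there (.there (.there .here))))

end Variables

namespace Sub

/-- The last variable is replaced by `t`, the others are replaced according to `θ`. -/
def cons {Γ Δ : Ctx} {σ : Ty} (t : Tm Δ σ) (θ : Sub Γ Δ) : Sub (σ :: Γ) Δ
  | _, .here => t
  | _, .there x => θ _ x

/-- A substitution pushed under a binder. -/
def lift {Γ Δ : Ctx} {σ : Ty} (θ : Sub Γ Δ) : Sub (σ :: Γ) (σ :: Δ) :=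
  cons v0 (fun τ x => (θ τ x).wk)

/-- The last variable is replaced by `t`, the others are kept. -/
def inst {Γ : Ctx} {σ : Ty} (t : Tm Γ σ) : Sub (σ :: Γ) Γ :=
  cons t (fun _ x => .var x)

/-- The last variable `x` of type `0` is replaced by its successor, the others are kept. -/
def succ {Γ : Ctx} : Sub (N0 :: Γ) (N0 :: Γ) :=
  cons (.cst .succ ⬝ v0) (fun _ x => .var (.there x))

/-- In the context `f¹, x⁰` the variable `x` is replaced by `F(f)`, where `F²` is a new
variable bound outside of `f`. -/
def choice {Γ : Ctx} : Sub (N0 :: N1 :: Γ) (N1 :: N2 :: Γ) :=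
  cons (v1 ⬝ v0) (cons v0 (fun _ x => .var (.there (.there x))))

end Sub

namespace Fm

/-- Application of a simultaneous substitution. -/
def subst : {Γ Δ : Ctx} → Sub Γ Δ → Fm Γ → Fm Δ
  | _, _, θ, .eq s t => .eq (s.subst θ) (t.subst θ)
  | _, _, _, .bot => .bot
  | _, _, θ, .imp A B => .imp (A.subst θ) (B.subst θ)
  | _, _, θ, .all σ A => .all σ (A.subst θ.lift)

/-- Weakening by one fresh variable. -/
def wk {Γ : Ctx} {σ : Ty} (A : Fm Γ) : Fm (σ :: Γ) :=
  A.subst (fun _ x => .var (.there x))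

/-- Replacement of the last variable by a term. -/
def inst {Γ : Ctx} {σ : Ty} (A : Fm (σ :: Γ)) (t : Tm Γ σ) : Fm Γ :=
  A.subst (Sub.inst t)

/-- Negation. -/
def neg {Γ : Ctx} (A : Fm Γ) : Fm Γ := .imp A .bot
/-- Conjunction. -/
def and {Γ : Ctx} (A B : Fm Γ) : Fm Γ := neg (.imp A (neg B))
/-- Equivalence. -/
def iff {Γ : Ctx} (A B : Fm Γ) : Fm Γ := and (.imp A B) (.imp B A)
/-- Existential quantification. -/
def ex {Γ : Ctx} (σ : Ty) (A : Fm (σ :: Γ)) : Fm Γ := neg (.all σ (neg A))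

/-- Quantifier-free formulas. -/
def QF : {Γ : Ctx} → Fm Γ → Prop
  | _, .eq _ _ => True
  | _, .bot => True
  | _, .imp A B => A.QF ∧ B.QF
  | _, .all _ _ => False

/-- Equality `s =_τ t` of objects of type `τ = (τ₁ → … → τₖ → 0)`, which stands for
`∀ z₁ … zₖ, s z₁ … zₖ =₀ t z₁ … zₖ`. -/
def eqTy : {Γ : Ctx} → (τ : Ty) → Tm Γ τ → Tm Γ τ → Fm Γ
  | _, .zero, s, t => .eq s t
  | _, .arr σ τ, s, t => .all σ (eqTy τ (s.wk ⬝ v0) (t.wk ⬝ v0))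

end Fm

/-! ### The system `RCA₀^ω` -/

/-- The non-logical axioms of `RCA₀^ω = E-PRA^ω + QF-AC^{1,0}`, with arbitrary terms and formulas
(in the free variables `Γ`) as instances. -/
inductive RCAAx {Γ : Ctx} : Fm Γ → Prop
  | eq_refl (x : Tm Γ N0) : RCAAx (.eq x x)
  | eq_symm (x y : Tm Γ N0) : RCAAx (.imp (.eq x y) (.eq y x))
  | eq_trans (x y z : Tm Γ N0) : RCAAx (.imp (.eq x y) (.imp (.eq y z) (.eq x z)))
  /-- `S x ≠ 0` -/
  | succ_ne_zero (x : Tm Γ N0) : RCAAx (Fm.neg (.eq (.cst .succ ⬝ x) (.cst .zero)))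
  /-- `S x = S y → x = y` -/
  | succ_inj (x y : Tm Γ N0) :
      RCAAx (.imp (.eq (.cst .succ ⬝ x) (.cst .succ ⬝ y)) (.eq x y))
  /-- `Π x y = x` -/
  | proj (ρ τ : Ty) (x : Tm Γ ρ) (y : Tm Γ τ) :
      RCAAx (Fm.eqTy ρ (.cst (.proj ρ τ) ⬝ x ⬝ y) x)
  /-- `Σ x y z = x z (y z)` -/
  | comb (δ ρ τ : Ty) (x : Tm Γ (δ ⇾ ρ ⇾ τ)) (y : Tm Γ (δ ⇾ ρ)) (z : Tm Γ δ) :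
      RCAAx (Fm.eqTy τ (.cst (.comb δ ρ τ) ⬝ x ⬝ y ⬝ z) (x ⬝ z ⬝ (y ⬝ z)))
  /-- `R₀ 0 y z = y` -/
  | recr_zero (y : Tm Γ N0) (z : Tm Γ (N0 ⇾ N0 ⇾ N0)) :
      RCAAx (.eq (.cst .recr ⬝ .cst .zero ⬝ y ⬝ z) y)
  /-- `R₀ (S x) y z = z (R₀ x y z) x` -/
  | recr_succ (x y : Tm Γ N0) (z : Tm Γ (N0 ⇾ N0 ⇾ N0)) :
      RCAAx (.eq (.cst .recr ⬝ (.cst .succ ⬝ x) ⬝ y ⬝ z) (z ⬝ (.cst .recr ⬝ x ⬝ y ⬝ z) ⬝ x))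
  /-- The axiom of extensionality, in all types. -/
  | ext (ρ τ : Ty) (φ : Tm Γ (ρ ⇾ τ)) (x y : Tm Γ ρ) :
      RCAAx (.imp (Fm.eqTy ρ x y) (Fm.eqTy τ (φ ⬝ x) (φ ⬝ y)))
  /-- Quantifier-free induction, with parameters of all types. -/
  | qf_ind (A : Fm (N0 :: Γ)) (hA : A.QF) :
      RCAAx (.imp (A.inst (.cst .zero))
        (.imp (.all N0 (.imp A (A.subst Sub.succ))) (.all N0 A)))
  /-- Quantifier-free choice `∀f¹ ∃x⁰ A(f,x) → ∃F² ∀f¹ A(f,F(f))`, with parameters of all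
  types. -/
  | qf_ac (A : Fm (N0 :: N1 :: Γ)) (hA : A.QF) :
      RCAAx (.imp (.all N1 (Fm.ex N0 A)) (Fm.ex N2 (.all N1 (A.subst Sub.choice))))

/-- Natural deduction for classical many-sorted logic over the axioms of `RCA₀^ω`:
`Prov H A` says that `A` is derivable from the hypotheses `H`. -/
inductive Prov : {Γ : Ctx} → List (Fm Γ) → Fm Γ → Prop
  | ax {Γ : Ctx} {H : List (Fm Γ)} {A : Fm Γ} : RCAAx A → Prov H A
  | hyp {Γ : Ctx} {H : List (Fm Γ)} {A : Fm Γ} : A ∈ H → Prov H A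
  | imp_intro {Γ : Ctx} {H : List (Fm Γ)} {A B : Fm Γ} : Prov (A :: H) B → Prov H (.imp A B)
  | imp_elim {Γ : Ctx} {H : List (Fm Γ)} {A B : Fm Γ} :
      Prov H (.imp A B) → Prov H A → Prov H B
  | by_contra {Γ : Ctx} {H : List (Fm Γ)} {A : Fm Γ} : Prov (A.neg :: H) .bot → Prov H A
  | all_intro {Γ : Ctx} {H : List (Fm Γ)} {σ : Ty} {A : Fm (σ :: Γ)} :
      Prov (H.map Fm.wk) A → Prov H (.all σ A)
  | all_elim {Γ : Ctx} {H : List (Fm Γ)} {σ : Ty} {A : Fm (σ :: Γ)} :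
      Prov H (.all σ A) → (t : Tm Γ σ) → Prov H (A.inst t)

/-- `RCA₀^ω` proves the sentence `A`. -/
def RCAProves (A : Fm []) : Prop := Prov [] A

/-! ### Elementary functions as closed terms -/

namespace Tm

/-- The numeral `0`. -/
abbrev Z {Γ : Ctx} : Tm Γ N0 := .cst .zero
/-- The successor of a term. -/
abbrev S {Γ : Ctx} (t : Tm Γ N0) : Tm Γ N0 := .cst .succ ⬝ t
/-- `recN n y z` is `R₀ n y z`: start with `y` and apply `z (value so far) (index)`. -/
abbrev recN {Γ : Ctx} (n y : Tm Γ N0) (z : Tm Γ (N0 ⇾ N0 ⇾ N0)) : Tm Γ N0 :=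
  .cst .recr ⬝ n ⬝ y ⬝ z

/-- `λ a b. a + b` -/
def add : Tm [] (N0 ⇾ N0 ⇾ N0) := lam (lam (recN v0 v1 (lam (lam (S v1)))))

/-- The predecessor, `0` at `0`. -/
def pred : Tm [] N1 := lam (recN v0 Z (lam (lam v0)))

/-- Truncated subtraction `λ a b. a ∸ b`. -/
def monus : Tm [] (N0 ⇾ N0 ⇾ N0) := lam (lam (recN v0 v1 (lam (lam (pred.emb ⬝ v1)))))

/-- `λ n a b.` if `n = 0` then `a`, else `b`. -/
def cond : Tm [] (N0 ⇾ N0 ⇾ N0 ⇾ N0) := lam (lam (lam (recN v2 v1 (lam (lam v2)))))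

/-- The triangular numbers `λ n. 0 + 1 + … + n`. -/
def tri : Tm [] N1 := lam (recN v0 Z (lam (lam (S (add.emb ⬝ v1 ⬝ v0)))))

/-- The Cantor pairing function `⟨a,b⟩ = (0 + 1 + … + (a + b)) + b`. -/
def pair : Tm [] (N0 ⇾ N0 ⇾ N0) :=
  lam (lam (add.emb ⬝ (tri.emb ⬝ (add.emb ⬝ v1 ⬝ v0)) ⬝ v0))

/-- The largest `w` whose triangular number is at most the argument, that is `a + b` at
`⟨a,b⟩`. -/
def diag : Tm [] N1 :=
  lam (recN v0 Z (lam (lam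
    (cond.emb ⬝ (monus.emb ⬝ (tri.emb ⬝ S v1) ⬝ S v0) ⬝ S v1 ⬝ v1))))

/-- The second projection of the pairing function. -/
def snd : Tm [] N1 := lam (monus.emb ⬝ v0 ⬝ (tri.emb ⬝ (diag.emb ⬝ v0)))

/-- The first projection of the pairing function. -/
def fst : Tm [] N1 := lam (monus.emb ⬝ (diag.emb ⬝ v0) ⬝ (snd.emb ⬝ v0))

/-- Every number codes a sequence: `l` codes the sequence of first entry `fst l` and of rest
`snd l` (so `0` codes `0, 0, 0, …`).  `drop l i` codes the sequence without its first `i`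
entries. -/
def drop : Tm [] (N0 ⇾ N0 ⇾ N0) := lam (lam (recN v0 v1 (lam (lam (snd.emb ⬝ v1)))))

/-- Entry `i` of the sequence coded by `l`. -/
def get : Tm [] (N0 ⇾ N0 ⇾ N0) := lam (lam (fst.emb ⬝ (drop.emb ⬝ v1 ⬝ v0)))

/-- `set l i v` is the sequence coded by `l` with entry `i` changed to `v`; it is built from
`⟨v, drop l (i + 1)⟩` by putting the entries `i - 1, …, 0` in front. -/
def set : Tm [] (N0 ⇾ N0 ⇾ N0 ⇾ N0) :=
  lam (lam (lam (recN v1 (pair.emb ⬝ v0 ⬝ (drop.emb ⬝ v2 ⬝ S v1))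
    (lam (lam (pair.emb ⬝ (get.emb ⬝ v4 ⬝ (monus.emb ⬝ v3 ⬝ S v0)) ⬝ v1))))))

/-- The code `λ f n. ⟨f 0, …, f (n - 1)⟩` of an initial segment of `f`. -/
def bar : Tm [] (N1 ⇾ N0 ⇾ N0) :=
  lam (lam (recN v0 Z (lam (lam (S (pair.emb ⬝ v1 ⬝ (v3 ⬝ v0)))))))

/-! ### Oracle machines

A program `e` codes its sequence of instructions.  The machine has registers `r₀, r₁, …`, coded by
one number, and a program counter `p`.  An instruction `⟨op, ⟨m, n⟩⟩` means:
* `op = 0`: halt;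
* `op = 1`: increase `rₘ` by one, and go to `p + 1`;
* `op = 2`: if `rₘ = 0`, go to `n`; otherwise decrease `rₘ` by one, and go to `p + 1`;
* `op ≥ 3`: put the oracle value `A(rₘ)` into `rₙ`, and go to `p + 1`.
-/

/-- The effect of the instruction `⟨op, ⟨m, n⟩⟩` at program counter `p` and registers `r`, as a new
configuration `⟨p', r'⟩`; the arguments are `A op m n c` where `c = ⟨p, r⟩`. -/
def exec : Tm [] (N1 ⇾ N0 ⇾ N0 ⇾ N0 ⇾ N0 ⇾ N0) :=
  let A : Tm [N0, N0, N0, N0, N1] N1 := v4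
  let op : Tm [N0, N0, N0, N0, N1] N0 := v3
  let m : Tm [N0, N0, N0, N0, N1] N0 := v2
  let n : Tm [N0, N0, N0, N0, N1] N0 := v1
  let c : Tm [N0, N0, N0, N0, N1] N0 := v0
  let p := fst.emb ⬝ c
  let r := snd.emb ⬝ c
  let rm := get.emb ⬝ r ⬝ m
  lam (lam (lam (lam (lam
    (cond.emb ⬝ op ⬝ c ⬝
      (cond.emb ⬝ (pred.emb ⬝ op) ⬝
        (pair.emb ⬝ S p ⬝ (set.emb ⬝ r ⬝ m ⬝ S rm)) ⬝
        (cond.emb ⬝ (pred.emb ⬝ (pred.emb ⬝ op)) ⬝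
          (cond.emb ⬝ rm ⬝ (pair.emb ⬝ n ⬝ r) ⬝
            (pair.emb ⬝ S p ⬝ (set.emb ⬝ r ⬝ m ⬝ (pred.emb ⬝ rm)))) ⬝
          (pair.emb ⬝ S p ⬝ (set.emb ⬝ r ⬝ n ⬝ (A ⬝ rm))))))))))

/-- `λ e c.` the instruction of the program `e` that is due in the configuration `c`. -/
def instr : Tm [] (N0 ⇾ N0 ⇾ N0) := lam (lam (get.emb ⬝ v1 ⬝ (fst.emb ⬝ v0)))

/-- `λ A e c.` the configuration after `c`. -/
def step : Tm [] (N1 ⇾ N0 ⇾ N0 ⇾ N0) :=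
  let A : Tm [N0, N0, N1] N1 := v2
  let e : Tm [N0, N0, N1] N0 := v1
  let c : Tm [N0, N0, N1] N0 := v0
  let i := instr.emb ⬝ e ⬝ c
  lam (lam (lam (exec.emb ⬝ A ⬝ (fst.emb ⬝ i) ⬝ (fst.emb ⬝ (snd.emb ⬝ i)) ⬝
    (snd.emb ⬝ (snd.emb ⬝ i)) ⬝ c)))

/-- `λ A e x s.` the configuration of the program `e` with oracle `A` after `s` steps, where the
start is at instruction `0` with `x` in register `0` and `0` in all other registers. -/
def run : Tm [] (N1 ⇾ N0 ⇾ N0 ⇾ N0 ⇾ N0) :=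
  lam (lam (lam (lam (recN v0 (pair.emb ⬝ Z ⬝ (pair.emb ⬝ v1 ⬝ Z))
    (lam (lam (step.emb ⬝ .var (.there (.there (.there (.there (.there .here))))) ⬝ v4 ⬝ v1)))))))

end Tm

namespace Fm
open Tm

/-- `Φ_{e,s}^A(x) = y`: after `s` steps the program `e` with oracle `A` and input `x` has
halted, with `y` in register `0`. -/
def phi {Γ : Ctx} (A : Tm Γ N1) (e x s y : Tm Γ N0) : Fm Γ :=
  let c := run.emb ⬝ A ⬝ e ⬝ x ⬝ s
  and (.eq (fst.emb ⬝ (instr.emb ⬝ e ⬝ c)) Z) (.eq (get.emb ⬝ (snd.emb ⬝ c) ⬝ Z) y)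

/-- `UDNR(Ψ)`: for all `A¹` and `e⁰`, not `Φ_e^A(e) = Ψ(A)(e)`. -/
def UDNRof {Γ : Ctx} (Ψ : Tm Γ (N1 ⇾ N1)) : Fm Γ :=
  .all N1 (.all N0 (neg (ex N0 (phi v2 v1 v1 v0 (Ψ.wk.wk.wk ⬝ v2 ⬝ v1)))))

/-- `MU(μ)`: for all `f¹`, if `∃n f(n) = 0` then `f(μ(f)) = 0`. -/
def MUof {Γ : Ctx} (μ : Tm Γ N2) : Fm Γ :=
  .all N1 (.imp (ex N0 (.eq (v1 ⬝ v0) Z)) (.eq (v0 ⬝ (μ.wk ⬝ v0)) Z))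

/-- `Ξ` is an extensionality functional for `Ψ`: for all `k⁰`, `f¹`, `g¹`, if `f` and `g` have the
same initial segment of length `Ξ(f,g,k)`, then `Ψ(f)` and `Ψ(g)` have the same initial segment of
length `k`. -/
def ExtFunctional {Γ : Ctx} (Ξ : Tm Γ (N1 ⇾ N1 ⇾ N0 ⇾ N0)) (Ψ : Tm Γ (N1 ⇾ N1)) : Fm Γ :=
  .all N0 (.all N1 (.all N1
    (let n := Ξ.wk.wk.wk ⬝ v1 ⬝ v0 ⬝ v2
     .imp (.eq (bar.emb ⬝ v1 ⬝ n) (bar.emb ⬝ v0 ⬝ n))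
      (.eq (bar.emb ⬝ (Ψ.wk.wk.wk ⬝ v1) ⬝ v2) (bar.emb ⬝ (Ψ.wk.wk.wk ⬝ v0) ⬝ v2)))))

/-- The sentence `UDNR`. -/
def UDNR : Fm [] := ex (N1 ⇾ N1) (UDNRof v0)

/-- The sentence `(μ²)`. -/
def muSq : Fm [] := ex N2 (MUof v0)

/-- The sentence `(∃²)`: `∃φ² ∀g¹ (∃x⁰ g(x) = 0 ↔ φ(g) = 0)`. -/
def existsSq : Fm [] :=
  ex N2 (.all N1 (iff (ex N0 (.eq (v1 ⬝ v0) Z)) (.eq (v1 ⬝ v0) Z)))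

end Fm

end HOArith

open HOArith

/-! The core is Grilliot's trick. Let `e` be the program `findPos`, which searches its oracle for a
positive value and outputs the predecessor of that value. Given Ψ, put c = Ψ(0)(e), where 0 is the
zero oracle. For a function f, let A_f (`probe`) take the value c + 1 at the zeros of f and 0
elsewhere. If f has a zero, then `e` halts on the oracle A_f with output c
(`exists_halted_findPos`), so Ψ(A_f)(e) ≠ c by diagonal nonrecursiveness (`IsUDNR.probe_ne`). If f
has no zero, then A_f is extensionally 0, so Ψ(A_f)(e) = c by the axiom of extensionality. Hence the
quantifier-free condition Ψ(A_f)(e) ≠ c decides whether f has a zero, and QF-AC turns it into μ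
(`IsUDNR.exists_isMu`). The same use of QF-AC derives (μ²) from (∃²).

An extensionality functional Ξ makes this explicit. If f has a zero, then Ψ(A_f) and Ψ(0) differ at
`e`, so A_f and 0 differ below Ξ(A_f, 0, e + 1). That number therefore bounds some zero of f, and a
bounded search finds one (`IsUDNR.isMu`). Conversely, μ locates a halting stage of program e on
input e whenever there is one, and the output at the located stage plus one is a value that the
program does not compute (`IsMu.isUDNR`).

Provability is obtained semantically. A Henkin construction gives completeness of the calculus for
extensional applicative structures in which `=₀` is identity (`RCAProves.of_forall_model`), so it is
enough to argue in an arbitrary model. Its numbers may be nonstandard. Arithmetic, pairing and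
machine runs are therefore developed from the axioms, with induction only for properties that can be
expressed by equations. -/

namespace HOArith

/-! ### Substitution -/

namespace Sub

/-- The identity substitution. -/
def id {Γ : Ctx} : Sub Γ Γ := fun _ x => .var x

/-- Composition of substitutions, `θ` first. -/
def comp {Γ Δ E : Ctx} (θ : Sub Γ Δ) (η : Sub Δ E) : Sub Γ E := fun τ x => (θ τ x).subst η

/-- The substitution that weakens by one variable. -/
def shift {Γ : Ctx} {σ : Ty} : Sub Γ (σ :: Γ) := fun _ x => .var (.there x)

end Sub

theorem Tm.subst_subst {Γ Δ E : Ctx} {τ : Ty} (t : Tm Γ τ) (θ : Sub Γ Δ) (η : Sub Δ E) :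
    (t.subst θ).subst η = t.subst (θ.comp η) := by
  induction t with
  | var x => rfl
  | cst c => rfl
  | app f a hf ha => simp only [Tm.subst, hf, ha]

theorem Tm.subst_id {Γ : Ctx} {τ : Ty} (t : Tm Γ τ) : t.subst Sub.id = t := by
  induction t with
  | var x => rfl
  | cst c => rfl
  | app f a hf ha => simp only [Tm.subst, hf, ha]

theorem Tm.wk_eq {Γ : Ctx} {σ τ : Ty} (t : Tm Γ τ) : (t.wk : Tm (σ :: Γ) τ) = t.subst Sub.shift :=
  rfl

theorem Sub.shift_comp_cons {Γ Δ : Ctx} {σ : Ty} (t : Tm Δ σ) (θ : Sub Γ Δ) :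
    Sub.shift.comp (Sub.cons t θ) = θ := rfl

theorem Sub.ext_cons {Γ Δ : Ctx} {σ : Ty} {θ η : Sub (σ :: Γ) Δ}
    (h : θ σ .here = η σ .here) (h' : ∀ τ x, θ τ (.there x) = η τ (.there x)) : θ = η := by
  funext τ x
  cases x with
  | here => exact h
  | there x => exact h' _ x

theorem Sub.cons_comp {Γ Δ E : Ctx} {σ : Ty} (t : Tm Δ σ) (θ : Sub Γ Δ) (η : Sub Δ E) :
    (Sub.cons t θ).comp η = Sub.cons (t.subst η) (θ.comp η) :=
  Sub.ext_cons rfl fun _ _ => rfl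

theorem Sub.lift_comp_cons {Γ Δ E : Ctx} {σ : Ty} (θ : Sub Γ Δ) (t : Tm E σ) (η : Sub Δ E) :
    θ.lift.comp (Sub.cons t η) = Sub.cons t (θ.comp η) := by
  refine Sub.ext_cons rfl fun τ x => ?_
  exact Tm.subst_subst _ _ _

theorem Sub.lift_comp_shift {Γ Δ : Ctx} {σ : Ty} (θ : Sub Γ Δ) :
    Sub.shift.comp (θ.lift (σ := σ)) = θ.comp Sub.shift := rfl

theorem Sub.lift_comp_lift {Γ Δ E : Ctx} {σ : Ty} (θ : Sub Γ Δ) (η : Sub Δ E) :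
    (θ.lift (σ := σ)).comp η.lift = (θ.comp η).lift := by
  refine Sub.ext_cons rfl fun τ x => ?_
  change ((θ τ x).subst Sub.shift).subst η.lift = ((θ τ x).subst η).subst Sub.shift
  rw [Tm.subst_subst, Tm.subst_subst, Sub.lift_comp_shift]

theorem Sub.lift_id {Γ : Ctx} {σ : Ty} : (Sub.id : Sub Γ Γ).lift (σ := σ) = Sub.id :=
  Sub.ext_cons rfl fun _ _ => rfl

theorem Tm.wk_subst_lift {Γ Δ : Ctx} {σ τ : Ty} (t : Tm Γ τ) (θ : Sub Γ Δ) :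
    (t.wk (σ := σ)).subst θ.lift = (t.subst θ).wk := by
  rw [Tm.wk_eq, Tm.wk_eq, Tm.subst_subst, Tm.subst_subst, Sub.lift_comp_shift]

namespace Fm

theorem subst_subst {Γ Δ E : Ctx} (A : Fm Γ) (θ : Sub Γ Δ) (η : Sub Δ E) :
    (A.subst θ).subst η = A.subst (θ.comp η) := by
  induction A generalizing Δ E with
  | eq s t => simp only [Fm.subst, Tm.subst_subst]
  | bot => rfl
  | imp A B hA hB => simp only [Fm.subst, hA, hB]
  | all σ A hA => simp only [Fm.subst, hA, Sub.lift_comp_lift]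

theorem subst_id {Γ : Ctx} (A : Fm Γ) : A.subst Sub.id = A := by
  induction A with
  | eq s t => simp only [Fm.subst, Tm.subst_id]
  | bot => rfl
  | imp A B hA hB => simp only [Fm.subst, hA, hB]
  | all σ A hA => simp only [Fm.subst, Sub.lift_id, hA]

theorem wk_eq {Γ : Ctx} {σ : Ty} (A : Fm Γ) : (A.wk : Fm (σ :: Γ)) = A.subst Sub.shift := rfl

theorem inst_eq {Γ : Ctx} {σ : Ty} (A : Fm (σ :: Γ)) (t : Tm Γ σ) :
    A.inst t = A.subst (Sub.cons t Sub.id) := rfl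

theorem wk_inst {Γ : Ctx} {σ : Ty} (A : Fm Γ) (t : Tm Γ σ) : A.wk.inst t = A := by
  rw [wk_eq, inst_eq, subst_subst, Sub.shift_comp_cons, subst_id]

theorem wk_subst_lift {Γ Δ : Ctx} {σ : Ty} (A : Fm Γ) (θ : Sub Γ Δ) :
    (A.wk (σ := σ)).subst θ.lift = (A.subst θ).wk := by
  rw [wk_eq, wk_eq, subst_subst, subst_subst, Sub.lift_comp_shift]

theorem subst_lift_inst {Γ Δ : Ctx} {σ : Ty} (A : Fm (σ :: Γ)) (θ : Sub Γ Δ) (t : Tm Δ σ) :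
    (A.subst θ.lift).inst t = A.subst (Sub.cons t θ) := by
  rw [inst_eq, subst_subst, Sub.lift_comp_cons]
  congr 2
  funext τ x
  exact Tm.subst_id _

theorem inst_subst {Γ Δ : Ctx} {σ : Ty} (A : Fm (σ :: Γ)) (t : Tm Γ σ) (θ : Sub Γ Δ) :
    (A.inst t).subst θ = (A.subst θ.lift).inst (t.subst θ) := by
  rw [subst_lift_inst, inst_eq, subst_subst, Sub.cons_comp]
  rfl

theorem eqTy_subst {Γ Δ : Ctx} (τ : Ty) (s t : Tm Γ τ) (θ : Sub Γ Δ) :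
    (eqTy τ s t).subst θ = eqTy τ (s.subst θ) (t.subst θ) := by
  induction τ generalizing Γ Δ with
  | zero => rfl
  | arr σ τ _ ih =>
    simp only [eqTy, Fm.subst, ih, Tm.subst, Tm.wk_subst_lift]
    rfl

theorem QF.subst {Γ Δ : Ctx} {A : Fm Γ} (h : A.QF) (θ : Sub Γ Δ) : (A.subst θ).QF := by
  induction A generalizing Δ with
  | eq s t => trivial
  | bot => trivial
  | imp A B hA hB => exact ⟨hA h.1 θ, hB h.2 θ⟩
  | all σ A hA => exact h.elim

end Fm

/-! ### Structural properties of derivability -/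

theorem RCAAx.subst {Γ Δ : Ctx} {A : Fm Γ} (h : RCAAx A) (θ : Sub Γ Δ) : RCAAx (A.subst θ) := by
  cases h with
  | eq_refl x => exact .eq_refl _
  | eq_symm x y => exact .eq_symm _ _
  | eq_trans x y z => exact .eq_trans _ _ _
  | succ_ne_zero x => exact .succ_ne_zero _
  | succ_inj x y => exact .succ_inj _ _
  | proj ρ τ x y => rw [Fm.eqTy_subst]; exact .proj _ _ _ _
  | comb δ ρ τ x y z => rw [Fm.eqTy_subst]; exact .comb _ _ _ _ _ _
  | recr_zero y z => exact .recr_zero _ _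
  | recr_succ x y z => exact .recr_succ _ _ _
  | ext ρ τ φ x y =>
    simp only [Fm.subst, Fm.eqTy_subst]
    exact .ext _ _ _ _ _
  | qf_ind A hA =>
    have h := RCAAx.qf_ind (A.subst θ.lift) (hA.subst _)
    have e : (A.subst Sub.succ).subst θ.lift = (A.subst θ.lift).subst Sub.succ := by
      rw [Fm.subst_subst, Fm.subst_subst]
      congr 1
      refine Sub.ext_cons rfl fun τ x => ?_
      change (θ τ x).wk = ((θ τ x).subst Sub.shift).subst Sub.succ
      rw [Tm.subst_subst]
      rfl
    simp only [Fm.subst, Fm.inst_subst, e]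
    exact h
  | qf_ac A hA =>
    have h := RCAAx.qf_ac (A.subst θ.lift.lift) (hA.subst _)
    have e : (A.subst Sub.choice).subst θ.lift.lift =
        (A.subst θ.lift.lift).subst Sub.choice := by
      rw [Fm.subst_subst, Fm.subst_subst]
      congr 1
      refine Sub.ext_cons rfl fun τ x => ?_
      -- The context binds both f and the number. The pointwise goal is folded back into an equality
      -- of substitutions, so that `Sub.ext_cons` can split off f as well.
      revert x
      revert τ
      rw [← funext_iff.trans (forall_congr' fun _ => funext_iff)]
      refine Sub.ext_cons rfl fun τ x => ?_
      change ((θ τ x).wk).wk = (((θ τ x).subst Sub.shift).subst Sub.shift).subst Sub.choice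
      rw [Tm.subst_subst, Tm.subst_subst, Tm.wk_eq, Tm.wk_eq, Tm.subst_subst]
      rfl
    simp only [Fm.subst, Fm.ex, Fm.neg, e]
    exact h

namespace Prov

theorem weaken {Γ : Ctx} {H H' : List (Fm Γ)} {A : Fm Γ} (h : Prov H A) (hH : H ⊆ H') :
    Prov H' A := by
  induction h with
  | ax h => exact .ax h
  | hyp h => exact .hyp (hH h)
  | imp_intro _ ih => exact .imp_intro (ih (List.cons_subset_cons _ hH))
  | imp_elim _ _ ih₁ ih₂ => exact .imp_elim (ih₁ hH) (ih₂ hH)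
  | by_contra _ ih => exact .by_contra (ih (List.cons_subset_cons _ hH))
  | all_intro _ ih => exact .all_intro (ih (List.map_subset _ hH))
  | all_elim _ t ih => exact .all_elim (ih hH) t

theorem subst {Γ Δ : Ctx} {H : List (Fm Γ)} {A : Fm Γ} (h : Prov H A) (θ : Sub Γ Δ) :
    Prov (H.map (Fm.subst θ)) (A.subst θ) := by
  induction h generalizing Δ with
  | ax h => exact .ax (h.subst θ)
  | hyp h => exact .hyp (List.mem_map_of_mem h)
  | imp_intro _ ih => exact .imp_intro (ih θ)
  | imp_elim _ _ ih₁ ih₂ => exact .imp_elim (ih₁ θ) (ih₂ θ)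
  | by_contra _ ih => exact .by_contra (ih θ)
  | all_intro _ ih =>
    refine .all_intro ?_
    have h := ih θ.lift
    rw [List.map_map] at h ⊢
    convert h using 2
    funext B
    exact (Fm.wk_subst_lift B θ).symm
  | all_elim _ t ih =>
    rw [Fm.inst_subst]
    exact .all_elim (ih θ) _

theorem ex_falso {Γ : Ctx} {H : List (Fm Γ)} (A : Fm Γ) (h : Prov H .bot) : Prov H A :=
  .by_contra (h.weaken (List.subset_cons_self _ _))

end Prov

/-- Every type has a closed term. -/
def Tm.dflt {Γ : Ctx} : (τ : Ty) → Tm Γ τ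
  | .zero => .cst .zero
  | .arr σ τ => .cst (.proj τ σ) ⬝ Tm.dflt τ

/-! ### Countability of the syntax -/

/-- An injective numbering of the types. -/
def Ty.code : Ty → ℕ
  | .zero => 0
  | .arr σ τ => Nat.pair σ.code τ.code + 1

theorem Ty.code_injective : Function.Injective Ty.code := by
  intro σ
  induction σ with
  | zero => intro τ h; cases τ <;> simp [Ty.code] at h ⊢
  | arr σ τ hσ hτ =>
    intro ρ h
    cases ρ with
    | zero => simp [Ty.code] at h
    | arr σ' τ' =>
      simp only [Ty.code, Nat.add_right_cancel_iff, Nat.pair_eq_pair] at h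
      rw [hσ h.1, hτ h.2]

/-- A numbering of the variables. -/
def Var.code : {Γ : Ctx} → {τ : Ty} → Var Γ τ → ℕ
  | _, _, .here => 0
  | _, _, .there x => x.code + 1

theorem Var.code_inj {Γ : Ctx} {σ τ : Ty} (x : Var Γ σ) (y : Var Γ τ) (h : x.code = y.code) :
    (⟨σ, x⟩ : Σ τ, Var Γ τ) = ⟨τ, y⟩ := by
  induction x with
  | here =>
    cases y with
    | here => rfl
    | there y => simp [Var.code] at h
  | there x ih =>
    cases y with
    | here => simp [Var.code] at h
    | there y =>
      have := ih y (by simpa [Var.code] using h)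
      cases this
      rfl

/-- A numbering of the constants. -/
def Cst.code : {τ : Ty} → Cst τ → ℕ
  | _, .zero => Nat.pair 0 0
  | _, .succ => Nat.pair 1 0
  | _, .recr => Nat.pair 2 0
  | _, .proj ρ τ => Nat.pair 3 (Nat.pair ρ.code τ.code)
  | _, .comb δ ρ τ => Nat.pair 4 (Nat.pair δ.code (Nat.pair ρ.code τ.code))

theorem Cst.code_inj {σ τ : Ty} (c : Cst σ) (d : Cst τ) (h : c.code = d.code) :
    (⟨σ, c⟩ : Σ τ, Cst τ) = ⟨τ, d⟩ := by
  cases c <;> cases d <;>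
    simp [Cst.code, Ty.code_injective.eq_iff] at h
  case proj => obtain ⟨rfl, rfl⟩ := h; rfl
  case comb => obtain ⟨rfl, rfl, rfl⟩ := h; rfl
  all_goals rfl

/-- A numbering of the terms. -/
def Tm.code {Γ : Ctx} : {τ : Ty} → Tm Γ τ → ℕ
  | _, .var x => Nat.pair 0 x.code
  | _, .cst c => Nat.pair 1 c.code
  | _, .app f a => Nat.pair 2 (Nat.pair f.code a.code)

/-- The argument type of an application cannot be read off from its own type. The induction
therefore has to compare terms of a priori different types. -/
theorem Tm.code_inj {Γ : Ctx} {σ τ : Ty} (s : Tm Γ σ) (t : Tm Γ τ) (h : s.code = t.code) :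
    (⟨σ, s⟩ : Σ τ, Tm Γ τ) = ⟨τ, t⟩ := by
  induction s generalizing τ with
  | var x =>
    cases t <;> simp [Tm.code] at h
    cases Var.code_inj _ _ h
    rfl
  | cst c =>
    cases t <;> simp [Tm.code] at h
    cases Cst.code_inj _ _ h
    rfl
  | app f a hf ha =>
    cases t <;> simp [Tm.code] at h
    cases hf _ h.1
    cases ha _ h.2
    rfl

/-- An injective numbering of the formulas. -/
def Fm.code : {Γ : Ctx} → Fm Γ → ℕ
  | _, .eq s t => Nat.pair 0 (Nat.pair s.code t.code)
  | _, .bot => Nat.pair 1 0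
  | _, .imp A B => Nat.pair 2 (Nat.pair A.code B.code)
  | _, .all σ A => Nat.pair 3 (Nat.pair σ.code A.code)

theorem Fm.code_injective {Γ : Ctx} : Function.Injective (Fm.code (Γ := Γ)) := by
  intro A
  induction A with
  | eq s t =>
    intro B h
    cases B <;> simp [Fm.code] at h
    cases Tm.code_inj _ _ h.1
    cases Tm.code_inj _ _ h.2
    rfl
  | bot =>
    intro B h
    cases B <;> simp [Fm.code] at h
    rfl
  | imp A B hA hB =>
    intro C h
    cases C <;> simp [Fm.code] at h
    rw [hA h.1, hB h.2]
  | all σ A hA =>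
    intro C h
    cases C <;> simp [Fm.code] at h
    obtain ⟨h₁, h₂⟩ := h
    cases Ty.code_injective h₁
    rw [hA h₂]

theorem Ty.exists_enum : ∃ f : ℕ → Ty, Function.Surjective f :=
  have : Countable Ty := Ty.code_injective.countable
  have : Nonempty Ty := ⟨.zero⟩
  exists_surjective_nat Ty

theorem Fm.exists_enum (Γ : Ctx) : ∃ f : ℕ → Fm Γ, Function.Surjective f :=
  have : Countable (Fm Γ) := Fm.code_injective.countable
  have : Nonempty (Fm Γ) := ⟨.bot⟩
  exists_surjective_nat (Fm Γ)

/-! ### Semantics -/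

/-- Extensional applicative structures for the language of arithmetic in all finite types. -/
structure AppStr where
  /-- The objects of each type. -/
  Obj : Ty → Type
  /-- Application. -/
  app {σ τ : Ty} : Obj (σ ⇾ τ) → Obj σ → Obj τ
  /-- The values of the constants. -/
  cst {τ : Ty} : Cst τ → Obj τ
  ext {σ τ : Ty} (f g : Obj (σ ⇾ τ)) : (∀ x, app f x = app g x) → f = g

namespace AppStr
variable (M : AppStr)

/-- Valuations of the variables. -/
abbrev Env (Γ : Ctx) : Type := ∀ τ : Ty, Var Γ τ → M.Obj τ

variable {M}

/-- The empty valuation. -/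
def Env.nil : M.Env [] := fun _ x => by cases x

/-- A valuation extended by the value of a new variable. -/
def Env.cons {Γ : Ctx} {σ : Ty} (a : M.Obj σ) (ν : M.Env Γ) : M.Env (σ :: Γ)
  | _, .here => a
  | _, .there x => ν _ x

theorem Env.ext_cons {Γ : Ctx} {σ : Ty} {θ η : M.Env (σ :: Γ)}
    (h : θ σ .here = η σ .here) (h' : ∀ τ x, θ τ (.there x) = η τ (.there x)) : θ = η := by
  funext τ x
  cases x with
  | here => exact h
  | there x => exact h' _ x

theorem Env.eq_nil (ν : M.Env []) : ν = Env.nil := by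
  funext τ x
  cases x

/-- The value of a term. -/
def val {Γ : Ctx} (ν : M.Env Γ) : {τ : Ty} → Tm Γ τ → M.Obj τ
  | _, .var x => ν _ x
  | _, .cst c => M.cst c
  | _, .app f a => M.app (val ν f) (val ν a)

/-- Truth of a formula. -/
def Holds : {Γ : Ctx} → M.Env Γ → Fm Γ → Prop
  | _, ν, .eq s t => val ν s = val ν t
  | _, _, .bot => False
  | _, ν, .imp A B => Holds ν A → Holds ν B
  | _, ν, .all _ A => ∀ a, Holds (ν.cons a) A

variable (M) in
/-- The applicative structure is a model of `RCA₀^ω`. -/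
def IsModel : Prop := ∀ {Γ : Ctx} (ν : M.Env Γ) (A : Fm Γ), RCAAx A → Holds ν A

end AppStr

/-! ### The completeness theorem -/

namespace Henkin

/-- The type of the Henkin constant introduced at stage `n`. -/
noncomputable def ty (n : ℕ) : Ty := Ty.exists_enum.choose n.unpair.1

/-- The context of the Henkin constants introduced before stage `n`. -/
noncomputable def G : ℕ → Ctx
  | 0 => []
  | n + 1 => ty n :: G n

/-- The inclusion of the constants available at stage `m` into those of a later stage `n`. -/
noncomputable def up {m n : ℕ} (h : m ≤ n) : Sub (G m) (G n) :=
  Nat.leRec (motive := fun n _ => Sub (G m) (G n)) Sub.id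
    (fun _ _ θ => (θ.comp Sub.shift : Sub (G m) (ty _ :: G _))) h

theorem up_self (n : ℕ) : up (le_refl n) = Sub.id := Nat.leRec_self _ _

theorem up_succ {m n : ℕ} (h : m ≤ n) :
    up (Nat.le_succ_of_le h) = ((up h).comp Sub.shift : Sub (G m) (ty n :: G n)) :=
  Nat.leRec_succ _ _ _

theorem up_comp_up {m n k : ℕ} (h : m ≤ n) (h' : n ≤ k) : (up h).comp (up h') = up (h.trans h') := by
  induction k, h' using Nat.le_induction with
  | base =>
    rw [up_self]
    funext τ x
    exact Tm.subst_id _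
  | succ k h' ih =>
    rw [up_succ h', up_succ (h.trans h'), ← ih]
    funext τ x
    exact (Tm.subst_subst _ _ _).symm

/-- The formula whose universal closure is decided at stage `n`. -/
noncomputable def job (n : ℕ) : Fm (ty n :: G n) :=
  ((Fm.exists_enum (ty n :: G n.unpair.2.unpair.2)).choose n.unpair.2.unpair.1).subst
    (up ((Nat.unpair_right_le _).trans (Nat.unpair_right_le _))).lift

theorem job_eq (n j i m : ℕ) (hj : n.unpair.1 = j) (hi : n.unpair.2.unpair.1 = i)
    (hm : n.unpair.2.unpair.2 = m) (h : m ≤ n) (e : ty n = Ty.exists_enum.choose j) :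
    job n = e ▸ ((Fm.exists_enum (Ty.exists_enum.choose j :: G m)).choose i).subst (up h).lift := by
  subst hj hi hm
  rfl

/-- A stage codes a type, the index of a formula and the index m of its context. Since m is at most
the code, the formula is already available when its turn comes. -/
theorem exists_job {m : ℕ} {σ : Ty} (B : Fm (σ :: G m)) :
    ∃ (n : ℕ) (h : m ≤ n) (e : ty n = σ), job n = e ▸ B.subst (up h).lift := by
  obtain ⟨j, rfl⟩ := Ty.exists_enum.choose_spec σ
  obtain ⟨i, rfl⟩ := (Fm.exists_enum (Ty.exists_enum.choose j :: G m)).choose_spec B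
  have e : ty (Nat.pair j (Nat.pair i m)) = Ty.exists_enum.choose j := by simp [ty]
  exact ⟨Nat.pair j (Nat.pair i m), (Nat.right_le_pair _ _).trans (Nat.right_le_pair _ _), e,
    job_eq _ _ _ _ (by simp) (by simp) (by simp) _ e⟩

/-! ### The complete Henkin theory -/

/-- Consistency of a list of formulas. -/
def Cons {Γ : Ctx} (H : List (Fm Γ)) : Prop := ¬ Prov H .bot

variable (H₀ : List (Fm []))

open Classical in
/-- The hypotheses collected before stage `n`. -/
noncomputable def Hyp : (n : ℕ) → List (Fm (G n))
  | 0 => H₀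
  | n + 1 =>
    if Cons ((Fm.all _ (job n)).neg :: Hyp n) then
      ((job n).neg :: (Hyp n).map Fm.wk : List (Fm (ty n :: G n)))
    else ((Hyp n).map Fm.wk : List (Fm (ty n :: G n)))

theorem hyp_succ_of_cons {n : ℕ} (h : Cons ((Fm.all _ (job n)).neg :: Hyp H₀ n)) :
    Hyp H₀ (n + 1) = ((job n).neg :: (Hyp H₀ n).map Fm.wk : List (Fm (ty n :: G n))) :=
  if_pos h

theorem hyp_succ_of_not_cons {n : ℕ} (h : ¬ Cons ((Fm.all _ (job n)).neg :: Hyp H₀ n)) :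
    Hyp H₀ (n + 1) = ((Hyp H₀ n).map Fm.wk : List (Fm (ty n :: G n))) :=
  if_neg h

theorem map_wk_subset (n : ℕ) :
    ((Hyp H₀ n).map Fm.wk : List (Fm (ty n :: G n))) ⊆ Hyp H₀ (n + 1) := by
  by_cases h : Cons ((Fm.all _ (job n)).neg :: Hyp H₀ n)
  · exact hyp_succ_of_cons H₀ h ▸ List.subset_cons_self _ _
  · exact hyp_succ_of_not_cons H₀ h ▸ List.Subset.refl _

theorem prov_up {m n : ℕ} (h : m ≤ n) {A : Fm (G m)} (hA : Prov (Hyp H₀ m) A) :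
    Prov (Hyp H₀ n) (A.subst (up h)) := by
  induction n, h using Nat.le_induction with
  | base => rwa [up_self, Fm.subst_id]
  | succ n h ih =>
    have := (ih.subst (Sub.shift (σ := ty n))).weaken (map_wk_subset H₀ n)
    rw [Fm.subst_subst, ← up_succ h] at this
    exact this

theorem cons_hyp (h₀ : Cons H₀) (n : ℕ) : Cons (Hyp H₀ n) := by
  induction n with
  | zero => exact h₀
  | succ n ih =>
    by_cases h : Cons ((Fm.all _ (job n)).neg :: Hyp H₀ n)
    · intro hb
      rw [hyp_succ_of_cons H₀ h] at hb
      -- The new constant is a fresh variable. A refutation of the negated instance at it thus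
      -- generalizes to a proof of the universal formula, against consistency.
      exact h (.imp_elim (.hyp (List.mem_cons_self ..))
        ((Prov.all_intro (Prov.by_contra hb)).weaken (List.subset_cons_self _ _)))
    · intro hb
      rw [hyp_succ_of_not_cons H₀ h] at hb
      -- A fresh constant alone is harmless because every type is inhabited by a closed term, which
      -- can replace it.
      exact ih (Prov.all_elim (Prov.all_intro hb) (Tm.dflt (ty n)))

/-- The formula `A` belongs to the complete Henkin theory. -/
def Th {n : ℕ} (A : Fm (G n)) : Prop := ∃ (k : ℕ) (h : n ≤ k), Prov (Hyp H₀ k) (A.subst (up h))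

variable {H₀}

theorem Th.of_prov {n : ℕ} {A : Fm (G n)} (h : Prov (Hyp H₀ n) A) : Th H₀ A :=
  ⟨n, le_rfl, by rwa [up_self, Fm.subst_id]⟩

theorem Th.of_ax {n : ℕ} {A : Fm (G n)} (h : RCAAx A) : Th H₀ A := .of_prov (.ax h)

theorem Th.up_iff {m n : ℕ} (h : m ≤ n) {A : Fm (G m)} : Th H₀ (A.subst (up h)) ↔ Th H₀ A := by
  constructor
  · rintro ⟨k, h', hk⟩
    rw [Fm.subst_subst, up_comp_up] at hk
    exact ⟨k, _, hk⟩
  · rintro ⟨k, h', hk⟩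
    refine ⟨max k n, le_max_right _ _, ?_⟩
    have := prov_up H₀ (le_max_left k n) hk
    rw [Fm.subst_subst, up_comp_up] at this ⊢
    exact this

theorem Th.mp {n : ℕ} {A B : Fm (G n)} (hAB : Th H₀ (.imp A B)) (hA : Th H₀ A) : Th H₀ B := by
  obtain ⟨k, h, hk⟩ := hAB
  obtain ⟨l, h', hl⟩ := hA
  refine ⟨max k l, h.trans (le_max_left _ _), ?_⟩
  have h₁ := prov_up H₀ (le_max_left k l) hk
  have h₂ := prov_up H₀ (le_max_right k l) hl
  rw [Fm.subst_subst, up_comp_up] at h₁ h₂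
  exact .imp_elim h₁ h₂

theorem Th.inst {n : ℕ} {σ : Ty} {A : Fm (σ :: G n)} (h : Th H₀ (.all σ A)) (t : Tm (G n) σ) :
    Th H₀ (A.inst t) := by
  obtain ⟨k, h, hk⟩ := h
  refine ⟨k, h, ?_⟩
  rw [Fm.inst_subst]
  exact .all_elim hk _

theorem not_th_bot (h₀ : Cons H₀) (n : ℕ) : ¬ Th H₀ (.bot : Fm (G n)) :=
  fun ⟨k, _, hk⟩ => cons_hyp H₀ h₀ k hk

/-- Stage k is the one that treats A. It either adds a counterexample, namely its own new constant,
or finds the negation of the universal closure inconsistent. This one dichotomy yields both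
completeness and the witness property. -/
theorem th_all_or {n : ℕ} {σ : Ty} (A : Fm (σ :: G n)) :
    Th H₀ (.all σ A) ∨
      ∃ (k : ℕ) (h : n ≤ k) (t : Tm (G k) σ), Th H₀ (A.subst (Sub.cons t (up h))).neg := by
  obtain ⟨k, h, rfl, hj⟩ := exists_job A
  by_cases hc : Cons ((Fm.all _ (job k)).neg :: Hyp H₀ k)
  · refine Or.inr ⟨k + 1, Nat.le_succ_of_le h, (v0 : Tm (ty k :: G k) _), .of_prov (.hyp ?_)⟩
    have hm : (job k).neg ∈ Hyp H₀ (k + 1) := by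
      rw [hyp_succ_of_cons H₀ hc]
      exact List.mem_cons_self ..
    rw [hj] at hm
    rw [up_succ h]
    exact hm
  · refine Or.inl ⟨k, h, ?_⟩
    have := Prov.by_contra (not_not.1 hc)
    rwa [hj] at this

/-- Deciding A amounts to deciding its closure over a dummy variable. -/
theorem th_or {n : ℕ} (A : Fm (G n)) : Th H₀ A ∨ Th H₀ A.neg := by
  rcases th_all_or (H₀ := H₀) (A.wk (σ := N0)) with h | ⟨k, h, t, ht⟩
  · exact Or.inl (by simpa only [Fm.wk_inst] using h.inst (Tm.dflt N0))
  · refine Or.inr ((Th.up_iff h).1 ?_)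
    rw [Fm.wk_eq, Fm.subst_subst, Sub.shift_comp_cons] at ht
    exact ht

theorem th_imp_iff {n : ℕ} {A B : Fm (G n)} :
    Th H₀ (.imp A B) ↔ (Th H₀ A → Th H₀ B) := by
  refine ⟨Th.mp, fun h => ?_⟩
  have key : ∀ {C D : Fm (G n)}, Th H₀ C → Prov [C] D → Th H₀ D := fun hC hD =>
    (Th.of_prov ((Prov.imp_intro hD).weaken (List.nil_subset _))).mp hC
  rcases th_or (H₀ := H₀) A with hA | hA
  · exact key (h hA) (.imp_intro (.hyp (by simp)))
  · exact key hA (.imp_intro (.ex_falso _ (.imp_elim (.hyp (by simp [Fm.neg]))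
      (.hyp (List.mem_cons_self ..)))))

theorem th_all_iff (h₀ : Cons H₀) {n : ℕ} {σ : Ty} {A : Fm (σ :: G n)} :
    Th H₀ (.all σ A) ↔
      ∀ (k : ℕ) (h : n ≤ k) (t : Tm (G k) σ), Th H₀ (A.subst (Sub.cons t (up h))) := by
  refine ⟨fun hA k h t => ?_, fun hA => ?_⟩
  · have := ((Th.up_iff h).2 hA).inst t
    rwa [Fm.subst_lift_inst] at this
  · refine (th_all_or A).resolve_right ?_
    rintro ⟨k, h, t, ht⟩
    exact not_th_bot h₀ _ (ht.mp (hA k h t))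

/-! #### Equality of the terms in the Henkin constants -/

/-- Equality of higher type is a universal formula, so by the Henkin property it only has to be
tested on terms of later stages. This reduces the equality rules to type 0 and makes the quotient
extensional. -/
theorem th_eqTy_arr_iff (h₀ : Cons H₀) {n : ℕ} {σ τ : Ty} {s t : Tm (G n) (σ ⇾ τ)} :
    Th H₀ (Fm.eqTy _ s t) ↔ ∀ (k : ℕ) (h : n ≤ k) (a : Tm (G k) σ),
      Th H₀ (Fm.eqTy τ (s.subst (up h) ⬝ a) (t.subst (up h) ⬝ a)) := by
  rw [Fm.eqTy, th_all_iff h₀]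
  refine forall_congr' fun k => forall_congr' fun h => forall_congr' fun a => ?_
  simp only [Fm.eqTy_subst, Tm.subst, Tm.wk_eq, Tm.subst_subst, Sub.shift_comp_cons]
  rfl

theorem th_eqTy_refl (h₀ : Cons H₀) {n : ℕ} {τ : Ty} (s : Tm (G n) τ) : Th H₀ (Fm.eqTy τ s s) := by
  induction τ generalizing n with
  | zero => exact .of_ax (.eq_refl s)
  | arr σ τ _ ih => exact (th_eqTy_arr_iff h₀).2 fun k h a => ih _

theorem th_eqTy_symm (h₀ : Cons H₀) {n : ℕ} {τ : Ty} {s t : Tm (G n) τ}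
    (h : Th H₀ (Fm.eqTy τ s t)) : Th H₀ (Fm.eqTy τ t s) := by
  induction τ generalizing n with
  | zero => exact (Th.of_ax (.eq_symm s t)).mp h
  | arr σ τ _ ih =>
    exact (th_eqTy_arr_iff h₀).2 fun k h' a => ih ((th_eqTy_arr_iff h₀).1 h k h' a)

theorem th_eqTy_trans (h₀ : Cons H₀) {n : ℕ} {τ : Ty} {s t u : Tm (G n) τ}
    (h : Th H₀ (Fm.eqTy τ s t)) (h' : Th H₀ (Fm.eqTy τ t u)) : Th H₀ (Fm.eqTy τ s u) := by
  induction τ generalizing n with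
  | zero => exact ((Th.of_ax (.eq_trans s t u)).mp h).mp h'
  | arr σ τ _ ih =>
    exact (th_eqTy_arr_iff h₀).2 fun k hk a =>
      ih ((th_eqTy_arr_iff h₀).1 h k hk a) ((th_eqTy_arr_iff h₀).1 h' k hk a)

/-- Equality of the functions is used by instantiation. Equality of the arguments needs the axiom of
extensionality. -/
theorem th_eqTy_app (h₀ : Cons H₀) {n : ℕ} {σ τ : Ty} {s t : Tm (G n) (σ ⇾ τ)} {a b : Tm (G n) σ}
    (h : Th H₀ (Fm.eqTy _ s t)) (h' : Th H₀ (Fm.eqTy σ a b)) :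
    Th H₀ (Fm.eqTy τ (s ⬝ a) (t ⬝ b)) := by
  have := (th_eqTy_arr_iff h₀).1 h n le_rfl a
  rw [up_self, Tm.subst_id, Tm.subst_id] at this
  exact th_eqTy_trans h₀ this ((Th.of_ax (.ext _ _ t a b)).mp h')

/-- Terms in the Henkin constants of some stage. -/
abbrev PreObj (τ : Ty) : Type := Σ n, Tm (G n) τ

/-- Provable equality of terms of possibly different stages. -/
def Eqv (H₀ : List (Fm [])) {τ : Ty} (p q : PreObj τ) : Prop :=
  Th H₀ (Fm.eqTy τ (p.2.subst (up (le_max_left p.1 q.1))) (q.2.subst (up (le_max_right p.1 q.1))))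

theorem eqv_iff {τ : Ty} {p q : PreObj τ} {k : ℕ} (hp : p.1 ≤ k) (hq : q.1 ≤ k) :
    Eqv H₀ p q ↔ Th H₀ (Fm.eqTy τ (p.2.subst (up hp)) (q.2.subst (up hq))) := by
  rw [Eqv, ← Th.up_iff (max_le hp hq), Fm.eqTy_subst, Tm.subst_subst, Tm.subst_subst, up_comp_up,
    up_comp_up]

/-- The setoid of provable equality. -/
def setoid (h₀ : Cons H₀) (τ : Ty) : Setoid (PreObj τ) where
  r := Eqv H₀
  iseqv := by
    refine ⟨fun p => th_eqTy_refl h₀ _, fun {p q} h => ?_, fun {p q r} h h' => ?_⟩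
    · exact (eqv_iff (le_max_right _ _) (le_max_left _ _)).2 (th_eqTy_symm h₀ h)
    · have hp : p.1 ≤ max p.1 (max q.1 r.1) := le_max_left _ _
      have hq : q.1 ≤ max p.1 (max q.1 r.1) := (le_max_left _ _).trans (le_max_right _ _)
      have hr : r.1 ≤ max p.1 (max q.1 r.1) := (le_max_right _ _).trans (le_max_right _ _)
      exact (eqv_iff hp hr).2 (th_eqTy_trans h₀ ((eqv_iff hp hq).1 h) ((eqv_iff hq hr).1 h'))

/-- Application of terms of possibly different stages. -/
noncomputable def preApp {σ τ : Ty} (p : PreObj (σ ⇾ τ)) (q : PreObj σ) : PreObj τ :=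
  ⟨max p.1 q.1, p.2.subst (up (le_max_left p.1 q.1)) ⬝ q.2.subst (up (le_max_right p.1 q.1))⟩

theorem preApp_eqv (h₀ : Cons H₀) {σ τ : Ty} {p p' : PreObj (σ ⇾ τ)} {q q' : PreObj σ}
    (h : Eqv H₀ p p') (h' : Eqv H₀ q q') : Eqv H₀ (preApp p q) (preApp p' q') := by
  have hp : p.1 ≤ max (max p.1 q.1) (max p'.1 q'.1) := by simp
  have hq : q.1 ≤ max (max p.1 q.1) (max p'.1 q'.1) := by simp
  have hp' : p'.1 ≤ max (max p.1 q.1) (max p'.1 q'.1) := by simp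
  have hq' : q'.1 ≤ max (max p.1 q.1) (max p'.1 q'.1) := by simp
  have := th_eqTy_app h₀ ((eqv_iff hp hp').1 h) ((eqv_iff hq hq').1 h')
  unfold Eqv preApp
  simpa only [Tm.subst, Tm.subst_subst, up_comp_up] using this

theorem eqv_up (h₀ : Cons H₀) {n k : ℕ} (h : n ≤ k) {τ : Ty} (t : Tm (G n) τ) :
    Eqv H₀ ⟨n, t⟩ ⟨k, t.subst (up h)⟩ := by
  refine (eqv_iff (k := k) h le_rfl).2 ?_
  rw [up_self, Tm.subst_id]
  exact th_eqTy_refl h₀ _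

theorem eqv_same {n : ℕ} {τ : Ty} {s t : Tm (G n) τ} :
    Eqv H₀ ⟨n, s⟩ ⟨n, t⟩ ↔ Th H₀ (Fm.eqTy τ s t) := by
  rw [eqv_iff (k := n) le_rfl le_rfl, up_self, Tm.subst_id, Tm.subst_id]

/-! #### The term model -/

/-- The class of a term of stage `n`. -/
def cls (h₀ : Cons H₀) {n : ℕ} {τ : Ty} (t : Tm (G n) τ) : Quotient (setoid h₀ τ) :=
  Quotient.mk _ ⟨n, t⟩

theorem cls_eq_iff (h₀ : Cons H₀) {n : ℕ} {τ : Ty} {s t : Tm (G n) τ} :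
    cls h₀ s = cls h₀ t ↔ Th H₀ (Fm.eqTy τ s t) :=
  Quotient.eq.trans eqv_same

theorem cls_up (h₀ : Cons H₀) {n k : ℕ} (h : n ≤ k) {τ : Ty} (t : Tm (G n) τ) :
    cls h₀ (t.subst (up h)) = cls h₀ t :=
  (Quotient.sound (eqv_up h₀ h t)).symm

theorem exists_cls (h₀ : Cons H₀) {τ : Ty} (x : Quotient (setoid h₀ τ)) (n : ℕ) :
    ∃ (k : ℕ) (_ : n ≤ k) (t : Tm (G k) τ), x = cls h₀ t := by
  induction x using Quotient.inductionOn with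
  | h p => exact ⟨max n p.1, le_max_left _ _, p.2.subst (up (le_max_right _ _)),
      (cls_up h₀ _ _).symm⟩

/-- Application of classes of terms. -/
noncomputable def clsApp (h₀ : Cons H₀) {σ τ : Ty} :
    Quotient (setoid h₀ (σ ⇾ τ)) → Quotient (setoid h₀ σ) → Quotient (setoid h₀ τ) :=
  Quotient.map₂ preApp fun _ _ h _ _ h' => preApp_eqv h₀ h h'

theorem clsApp_cls (h₀ : Cons H₀) {n : ℕ} {σ τ : Ty} (s : Tm (G n) (σ ⇾ τ)) (t : Tm (G n) σ) :
    clsApp h₀ (cls h₀ s) (cls h₀ t) = cls h₀ (s ⬝ t) := by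
  refine Quotient.sound ((eqv_iff (k := max n n) le_rfl (le_max_left n n)).2 ?_)
  change Th H₀ (Fm.eqTy τ ((s.subst (up (le_max_left n n)) ⬝ t.subst (up (le_max_right n n)) :
    Tm (G (max n n)) τ).subst (up le_rfl)) ((s ⬝ t).subst (up (le_max_left n n))))
  rw [up_self, Tm.subst_id]
  exact th_eqTy_refl h₀ _

/-- The term model. -/
noncomputable def model (h₀ : Cons H₀) : AppStr where
  Obj τ := Quotient (setoid h₀ τ)
  app := clsApp h₀
  cst c := cls h₀ (n := 0) (.cst c)
  ext {σ τ} f g h := by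
    obtain ⟨n, -, s, rfl⟩ := exists_cls h₀ f 0
    obtain ⟨k, hk, t, rfl⟩ := exists_cls h₀ g n
    rw [← cls_up h₀ hk s] at h ⊢
    refine (cls_eq_iff h₀).2 ((th_eqTy_arr_iff h₀).2 fun l hl a => ?_)
    have := h (cls h₀ a)
    rwa [← cls_up h₀ hl, ← cls_up h₀ hl t, clsApp_cls, clsApp_cls, cls_eq_iff] at this

/-! ### Truth in the term model -/

/-- The valuation in the term model given by a substitution. -/
def env (h₀ : Cons H₀) {Γ : Ctx} {n : ℕ} (θ : Sub Γ (G n)) : (model h₀).Env Γ :=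
  fun τ x => cls h₀ (θ τ x)

theorem env_cons (h₀ : Cons H₀) {Γ : Ctx} {n : ℕ} {σ : Ty} (t : Tm (G n) σ) (θ : Sub Γ (G n)) :
    env h₀ (Sub.cons t θ) = (env h₀ θ).cons (M := model h₀) (cls h₀ t) :=
  AppStr.Env.ext_cons rfl fun _ _ => rfl

theorem env_up (h₀ : Cons H₀) {Γ : Ctx} {n k : ℕ} (h : n ≤ k) (θ : Sub Γ (G n)) :
    env h₀ (θ.comp (up h)) = env h₀ θ := by
  funext τ x
  exact cls_up h₀ h _

theorem exists_env (h₀ : Cons H₀) {Γ : Ctx} (ν : (model h₀).Env Γ) :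
    ∃ (n : ℕ) (θ : Sub Γ (G n)), ν = env h₀ θ := by
  induction Γ with
  | nil => exact ⟨0, Sub.id, by funext τ x; cases x⟩
  | cons σ Γ ih =>
    obtain ⟨n, θ, hθ⟩ := ih fun τ x => ν τ (.there x)
    obtain ⟨k, hk, t, ht⟩ := exists_cls h₀ (ν σ .here) n
    refine ⟨k, Sub.cons t (θ.comp (up hk)), ?_⟩
    rw [env_cons, env_up]
    exact AppStr.Env.ext_cons ht fun τ x => congrFun (congrFun hθ τ) x

theorem val_env (h₀ : Cons H₀) {Γ : Ctx} {n : ℕ} (θ : Sub Γ (G n)) {τ : Ty} (t : Tm Γ τ) :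
    AppStr.val (env h₀ θ) t = cls h₀ (t.subst θ) := by
  induction t with
  | var x => rfl
  | cst c => exact (cls_up h₀ (Nat.zero_le n) (.cst c)).symm
  | app f a hf ha =>
    rw [AppStr.val, hf, ha]
    exact clsApp_cls h₀ _ _

/-- The truth lemma: the theory commutes with implication by completeness, and with quantifiers
because every object is the class of a term of an arbitrarily late stage. -/
theorem holds_env_iff (h₀ : Cons H₀) {Γ : Ctx} {n : ℕ} (θ : Sub Γ (G n)) (A : Fm Γ) :
    AppStr.Holds (env h₀ θ) A ↔ Th H₀ (A.subst θ) := by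
  induction A generalizing n with
  | eq s t =>
    rw [AppStr.Holds, val_env, val_env]
    exact cls_eq_iff h₀
  | bot => exact iff_of_false not_false (not_th_bot h₀ n)
  | imp A B hA hB => rw [AppStr.Holds, hA, hB, Fm.subst, th_imp_iff]
  | all σ A ih =>
    rw [AppStr.Holds, Fm.subst, th_all_iff h₀]
    have key (k : ℕ) (h : n ≤ k) (t : Tm (G k) σ) :
        AppStr.Holds ((env h₀ θ).cons (M := model h₀) (cls h₀ t)) A ↔
          Th H₀ ((A.subst θ.lift).subst (Sub.cons t (up h))) := by
      rw [← env_up h₀ h, ← env_cons, ih, Fm.subst_subst, Sub.lift_comp_cons]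
    refine ⟨fun hA k h t => (key k h t).1 (hA _), fun hA x => ?_⟩
    obtain ⟨k, h, t, rfl⟩ := exists_cls h₀ x n
    exact (key k h t).2 (hA k h t)

theorem model_isModel (h₀ : Cons H₀) : (model h₀).IsModel := by
  intro Γ ν A hA
  obtain ⟨n, θ, rfl⟩ := exists_env h₀ ν
  exact (holds_env_iff h₀ θ A).2 (.of_ax (hA.subst θ))

end Henkin

/-- Completeness: a sentence that holds in all models is provable. -/
theorem RCAProves.of_forall_model {A : Fm []}
    (h : ∀ M : AppStr, M.IsModel → AppStr.Holds (M := M) AppStr.Env.nil A) : RCAProves A := by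
  by_contra hA
  have h₀ : Henkin.Cons [A.neg] := fun hb => hA (.by_contra hb)
  have hn : Henkin.Th [A.neg] (n := 0) A.neg := .of_prov (.hyp (List.mem_cons_self ..))
  have hM (ν : (Henkin.model h₀).Env []) : ¬ AppStr.Holds ν A.neg := by
    rw [AppStr.Env.eq_nil ν]
    exact fun hν => hν (h _ (Henkin.model_isModel h₀))
  exact hM _ <| (Henkin.holds_env_iff h₀ (n := 0) (Sub.id (Γ := [])) A.neg).2
    ((Fm.subst_id A.neg).symm ▸ hn)

namespace AppStr
variable {M : AppStr}

infixl:75 " ⋆ " => AppStr.app _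

/-! ### Values of terms and truth of formulas -/

@[simp] theorem Env.cons_here {Γ : Ctx} {σ : Ty} (a : M.Obj σ) (ν : M.Env Γ) :
    ν.cons a σ .here = a := rfl

@[simp] theorem Env.cons_there {Γ : Ctx} {σ τ : Ty} (a : M.Obj σ) (ν : M.Env Γ) (x : Var Γ τ) :
    ν.cons a τ (.there x) = ν τ x := rfl

@[simp] theorem val_var {Γ : Ctx} (ν : M.Env Γ) {τ : Ty} (x : Var Γ τ) :
    val ν (.var x) = ν τ x := rfl

@[simp] theorem val_cst {Γ : Ctx} (ν : M.Env Γ) {τ : Ty} (c : Cst τ) :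
    val ν (.cst c) = M.cst c := rfl

@[simp] theorem val_app {Γ : Ctx} (ν : M.Env Γ) {σ τ : Ty} (f : Tm Γ (σ ⇾ τ)) (a : Tm Γ σ) :
    val ν (f ⬝ a) = val ν f ⋆ val ν a := rfl

theorem val_subst {Γ Δ : Ctx} (ν : M.Env Δ) (θ : Sub Γ Δ) {τ : Ty} (t : Tm Γ τ) :
    val ν (t.subst θ) = val (fun σ x => val ν (θ σ x)) t := by
  induction t with
  | var x => rfl
  | cst c => rfl
  | app f a hf ha => simp only [Tm.subst, val_app, hf, ha]

@[simp] theorem val_wk {Γ : Ctx} {σ τ : Ty} (ν : M.Env Γ) (a : M.Obj σ) (t : Tm Γ τ) :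
    val (ν.cons a) t.wk = val ν t :=
  val_subst _ _ _

/-- The value of a closed term. -/
def den {τ : Ty} (t : Tm [] τ) : M.Obj τ := val Env.nil t

@[simp] theorem val_emb {Γ : Ctx} {τ : Ty} (ν : M.Env Γ) (t : Tm [] τ) :
    val ν (t.emb) = den t :=
  (val_subst _ _ _).trans (congrArg (fun ν => val ν t) (Env.eq_nil _))

theorem holds_subst {Γ Δ : Ctx} (ν : M.Env Δ) (θ : Sub Γ Δ) (A : Fm Γ) :
    Holds ν (A.subst θ) ↔ Holds (fun σ x => val ν (θ σ x)) A := by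
  induction A generalizing Δ with
  | eq s t => simp only [Fm.subst, Holds, val_subst]
  | bot => rfl
  | imp A B hA hB => simp only [Fm.subst, Holds, hA, hB]
  | all σ A ih =>
    simp only [Fm.subst, Holds, ih]
    refine forall_congr' fun a => ?_
    rw [show (fun τ x => val (ν.cons a) (θ.lift τ x)) = Env.cons a fun τ x => val ν (θ τ x) from
      Env.ext_cons rfl fun τ x => val_wk ν a (θ τ x)]

@[simp] theorem holds_eq {Γ : Ctx} (ν : M.Env Γ) (s t : Tm Γ N0) :
    Holds ν (.eq s t) ↔ val ν s = val ν t := Iff.rfl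

@[simp] theorem holds_bot {Γ : Ctx} (ν : M.Env Γ) : Holds ν .bot ↔ False := Iff.rfl

@[simp] theorem holds_imp {Γ : Ctx} (ν : M.Env Γ) (A B : Fm Γ) :
    Holds ν (.imp A B) ↔ (Holds ν A → Holds ν B) := Iff.rfl

@[simp] theorem holds_all {Γ : Ctx} (ν : M.Env Γ) (σ : Ty) (A : Fm (σ :: Γ)) :
    Holds ν (.all σ A) ↔ ∀ a, Holds (ν.cons a) A := Iff.rfl

@[simp] theorem holds_neg {Γ : Ctx} (ν : M.Env Γ) (A : Fm Γ) :
    Holds ν A.neg ↔ ¬ Holds ν A := Iff.rfl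

@[simp] theorem holds_and {Γ : Ctx} (ν : M.Env Γ) (A B : Fm Γ) :
    Holds ν (A.and B) ↔ Holds ν A ∧ Holds ν B := by
  simp [Fm.and]

@[simp] theorem holds_iff {Γ : Ctx} (ν : M.Env Γ) (A B : Fm Γ) :
    Holds ν (A.iff B) ↔ (Holds ν A ↔ Holds ν B) := by
  simp [Fm.iff, iff_def]

@[simp] theorem holds_ex {Γ : Ctx} (ν : M.Env Γ) (σ : Ty) (A : Fm (σ :: Γ)) :
    Holds ν (.ex σ A) ↔ ∃ a, Holds (ν.cons a) A := by
  simp [Fm.ex]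

-- Extensionality of the structure collapses the defined equality to identity. In models the axioms
-- for Π and Σ then become rewriting rules.
@[simp] theorem holds_eqTy {Γ : Ctx} (ν : M.Env Γ) (τ : Ty) (s t : Tm Γ τ) :
    Holds ν (Fm.eqTy τ s t) ↔ val ν s = val ν t := by
  induction τ generalizing Γ with
  | zero => rfl
  | arr σ τ _ ih =>
    simp only [Fm.eqTy, holds_all, ih, val_app, val_wk]
    exact ⟨fun h => M.ext _ _ h, fun h a => by rw [h]⟩

theorem val_strengthen {Γ : Ctx} {σ : Ty} (ν : M.Env Γ) (a : M.Obj σ) : {τ : Ty} →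
    (t : Tm (σ :: Γ) τ) → (t' : Tm Γ τ) → t.strengthen = some t' → val (ν.cons a) t = val ν t'
  | _, .var .here, _, h => by cases h
  | _, .var (.there _), _, h => by cases h; rfl
  | _, .cst _, _, h => by cases h; rfl
  | _, .app f b, t', h => by
    simp only [Tm.strengthen] at h
    split at h
    · rename_i f' b' h₁ h₂
      cases h
      simp only [val_app, val_strengthen ν a f f' h₁, val_strengthen ν a b b' h₂]
    · cases h

/-! ### The axioms in a model -/

section Model
variable [hM : Fact M.IsModel]

@[simp] theorem proj_app {ρ τ : Ty} (x : M.Obj ρ) (y : M.Obj τ) : M.cst (.proj ρ τ) ⋆ x ⋆ y = x := by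
  simpa using hM.out ((Env.nil.cons y).cons x) _ (.proj ρ τ v0 v1)

@[simp] theorem comb_app {δ ρ τ : Ty} (x : M.Obj (δ ⇾ ρ ⇾ τ)) (y : M.Obj (δ ⇾ ρ)) (z : M.Obj δ) :
    M.cst (.comb δ ρ τ) ⋆ x ⋆ y ⋆ z = x ⋆ z ⋆ (y ⋆ z) := by
  simpa using hM.out (((Env.nil.cons z).cons y).cons x) _ (.comb δ ρ τ v0 v1 v2)

@[simp] theorem val_lam {Γ : Ctx} {σ : Ty} (ν : M.Env Γ) (a : M.Obj σ) : {τ : Ty} →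
    (t : Tm (σ :: Γ) τ) → val ν t.lam ⋆ a = val (ν.cons a) t
  | _, .var .here => by simp [Tm.lam]
  | _, .var (.there _) => by simp [Tm.lam]
  | _, .cst _ => by simp [Tm.lam]
  | _, .app f b => by
    simp only [Tm.lam]
    split
    · rename_i t h
      rw [val_strengthen ν a _ _ h]
      simp
    · simp [val_lam ν a f, val_lam ν a b]

end Model

/-! ### Elementary functions -/

/-- The successor of a number of the model. -/
def succ (x : M.Obj N0) : M.Obj N0 := M.cst .succ ⋆ x

instance : Zero (M.Obj N0) := ⟨M.cst .zero⟩

theorem cst_zero : M.cst .zero = 0 := rfl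

theorem cst_succ (x : M.Obj N0) : M.cst .succ ⋆ x = succ x := rfl

/-- The predecessor. -/
def pred (x : M.Obj N0) : M.Obj N0 := den Tm.pred ⋆ x

/-- Addition. -/
def add (x y : M.Obj N0) : M.Obj N0 := den Tm.add ⋆ x ⋆ y

instance : Add (M.Obj N0) := ⟨add⟩

theorem add_def (x y : M.Obj N0) : den Tm.add ⋆ x ⋆ y = x + y := rfl

/-- Truncated subtraction. -/
def monus (x y : M.Obj N0) : M.Obj N0 := den Tm.monus ⋆ x ⋆ y

instance : _root_.Sub (M.Obj N0) := ⟨monus⟩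

theorem sub_def (x y : M.Obj N0) : den Tm.monus ⋆ x ⋆ y = x - y := rfl

/-- Definition by cases. -/
def cond (x y z : M.Obj N0) : M.Obj N0 := den Tm.cond ⋆ x ⋆ y ⋆ z

theorem cond_def (x y z : M.Obj N0) : den Tm.cond ⋆ x ⋆ y ⋆ z = cond x y z := rfl

/-- The triangular numbers. -/
def tri (x : M.Obj N0) : M.Obj N0 := den Tm.tri ⋆ x

/-- The inverse of the triangular numbers, rounded down. -/
def diag (x : M.Obj N0) : M.Obj N0 := den Tm.diag ⋆ x

/-- The pairing function. -/
def pair (x y : M.Obj N0) : M.Obj N0 := den Tm.pair ⋆ x ⋆ y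

/-- The first projection. -/
def fst (x : M.Obj N0) : M.Obj N0 := den Tm.fst ⋆ x

/-- The second projection. -/
def snd (x : M.Obj N0) : M.Obj N0 := den Tm.snd ⋆ x

section Model
variable [hM : Fact M.IsModel]

@[simp] theorem succ_ne_zero (x : M.Obj N0) : succ x ≠ 0 :=
  hM.out (Env.nil.cons x) _ (.succ_ne_zero v0)

@[simp] theorem zero_ne_succ (x : M.Obj N0) : 0 ≠ succ x := (succ_ne_zero x).symm

theorem succ_inj {x y : M.Obj N0} (h : succ x = succ y) : x = y :=
  hM.out ((Env.nil.cons y).cons x) _ (.succ_inj v0 v1) h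

theorem recr_zero (y : M.Obj N0) (z : M.Obj (N0 ⇾ N0 ⇾ N0)) : M.cst .recr ⋆ 0 ⋆ y ⋆ z = y :=
  hM.out ((Env.nil.cons z).cons y) _ (.recr_zero v0 v1)

theorem recr_succ (x y : M.Obj N0) (z : M.Obj (N0 ⇾ N0 ⇾ N0)) :
    M.cst .recr ⋆ succ x ⋆ y ⋆ z = z ⋆ (M.cst .recr ⋆ x ⋆ y ⋆ z) ⋆ x :=
  hM.out (((Env.nil.cons z).cons y).cons x) _ (.recr_succ v0 v1 v2)

/-- A function that is defined by the recursor satisfies the recursion equations. -/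
theorem recursion_eqs {F : M.Obj N0 → M.Obj N0} {y : M.Obj N0}
    (φ : M.Obj N0 → M.Obj N0 → M.Obj N0)
    (h : ∀ n, ∃ z, F n = M.cst .recr ⋆ n ⋆ y ⋆ z ∧ ∀ a i, z ⋆ a ⋆ i = φ a i) :
    F 0 = y ∧ ∀ n, F (succ n) = φ (F n) n := by
  -- The step object `z` may depend on `n`, since an abstraction is evaluated in an environment that
  -- contains `n`. All these objects act as `φ`, so extensionality identifies them.
  obtain ⟨z, -, hz⟩ := h 0
  have hF (n : M.Obj N0) : F n = M.cst .recr ⋆ n ⋆ y ⋆ z := by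
    obtain ⟨z', h', hz'⟩ := h n
    rw [h', M.ext z' z fun a => M.ext _ _ fun i => by rw [hz', hz]]
  exact ⟨by rw [hF, recr_zero], fun n => by rw [hF, recr_succ, hz, ← hF]⟩

/-- Quantifier-free choice in the form that is used below. -/
theorem exists_choice (b : M.Obj N2) (c : M.Obj N0) (h : ∀ f, b ⋆ f ≠ c → ∃ n, f ⋆ n = 0) :
    ∃ F : M.Obj N2, ∀ f, b ⋆ f ≠ c → f ⋆ (F ⋆ f) = 0 := by
  -- The matrix is `b f ≠ c → f n = 0`. Where `b f = c` any value serves, and 0 is taken.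
  have := hM.out ((Env.nil.cons c).cons b) _
    (.qf_ac (.imp (Fm.neg (.eq (v2 ⬝ v1) v3)) (.eq (v1 ⬝ v0) Tm.Z)) ⟨⟨trivial, trivial⟩, trivial⟩)
  simp only [holds_imp, holds_all, holds_ex, holds_neg, holds_eq, holds_subst, val_app, val_var,
    val_cst, Env.cons_here, Env.cons_there, Sub.choice, Sub.cons] at this
  refine this fun f => ?_
  by_cases hf : b ⋆ f = c
  · exact ⟨0, fun h => absurd hf h⟩
  · exact (h f hf).imp fun _ hn _ => hn

/-! ### Representable functions and induction -/

/-- The function is given by an object of the model. -/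
@[fun_prop]
def Rep {σ τ : Ty} (g : M.Obj σ → M.Obj τ) : Prop := ∃ f : M.Obj (σ ⇾ τ), ∀ x, f ⋆ x = g x

@[fun_prop]
theorem Rep.id {σ : Ty} : Rep (M := M) (σ := σ) fun x => x :=
  ⟨M.cst (.comb σ (σ ⇾ σ) σ) ⋆ M.cst (.proj σ (σ ⇾ σ)) ⋆ M.cst (.proj σ σ), by simp⟩

@[fun_prop]
theorem Rep.const {σ τ : Ty} (y : M.Obj τ) : Rep fun _ : M.Obj σ => y :=
  ⟨M.cst (.proj τ σ) ⋆ y, by simp⟩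

-- Application is handled by the combinator Σ. With `Rep.id` and `Rep.const` this is bracket
-- abstraction, so `fun_prop` carries out combinatory completeness.
@[fun_prop]
theorem Rep.app {σ ρ τ : Ty} {g : M.Obj σ → M.Obj (ρ ⇾ τ)} {h : M.Obj σ → M.Obj ρ} (hg : Rep g)
    (hh : Rep h) : Rep fun x => g x ⋆ h x := by
  obtain ⟨g', hg⟩ := hg
  obtain ⟨h', hh⟩ := hh
  exact ⟨M.cst (.comb σ ρ τ) ⋆ g' ⋆ h', by simp [hg, hh]⟩

@[fun_prop]
theorem Rep.comp {σ ρ τ : Ty} {g : M.Obj ρ → M.Obj τ} {h : M.Obj σ → M.Obj ρ} (hg : Rep g)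
    (hh : Rep h) : Rep fun x => g (h x) := by
  obtain ⟨g', hg⟩ := hg
  simpa only [hg] using (Rep.const g').app hh

@[fun_prop]
theorem Rep.succ {σ : Ty} {g : M.Obj σ → M.Obj N0} (hg : Rep g) : Rep fun x => succ (g x) :=
  (Rep.const _).app hg

/-- Induction for a disjunction of two equations. -/
theorem induction_or {g h g' h' : M.Obj N0 → M.Obj N0} (hg : Rep g) (hh : Rep h) (hg' : Rep g')
    (hh' : Rep h') (h₀ : g 0 = h 0 ∨ g' 0 = h' 0)
    (hs : ∀ x, g x = h x ∨ g' x = h' x → g (succ x) = h (succ x) ∨ g' (succ x) = h' (succ x))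
    (x : M.Obj N0) : g x = h x ∨ g' x = h' x := by
  obtain ⟨a, ha⟩ := hg
  obtain ⟨b, hb⟩ := hh
  obtain ⟨a', ha'⟩ := hg'
  obtain ⟨b', hb'⟩ := hh'
  -- The disjunction is written as `¬ (g x = h x) → g' x = h' x` with the functions as parameters,
  -- which is quantifier-free.
  have := hM.out ((((Env.nil.cons b').cons a').cons b).cons a) _
    (.qf_ind (.imp (Fm.neg (.eq (v1 ⬝ v0) (v2 ⬝ v0))) (.eq (v3 ⬝ v0) (v4 ⬝ v0)))
      ⟨⟨trivial, trivial⟩, trivial⟩)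
  simp only [holds_imp, holds_all, holds_neg, holds_eq, holds_subst, val_app, val_var, Fm.inst,
    val_cst, Env.cons_here, Env.cons_there, Sub.succ, Sub.inst, Sub.cons, ha, hb, ha', hb', cst_zero,
    cst_succ, ← or_iff_not_imp_left] at this
  exact this h₀ hs x

/-- Induction for an equation. -/
theorem induction_eq {g h : M.Obj N0 → M.Obj N0} (hg : Rep g) (hh : Rep h) (h₀ : g 0 = h 0)
    (hs : ∀ x, g x = h x → g (succ x) = h (succ x)) (x : M.Obj N0) : g x = h x := by
  have := induction_or hg hh hg hh (Or.inl h₀) (fun x hx => by simpa using hs x (by simpa using hx)) x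
  simpa using this

/-! ### Arithmetic -/

@[fun_prop]
theorem Rep.pred {σ : Ty} {g : M.Obj σ → M.Obj N0} (hg : Rep g) : Rep fun x => pred (g x) :=
  (Rep.const _).app hg

theorem pred_eqs : pred (0 : M.Obj N0) = 0 ∧ ∀ x : M.Obj N0, pred (succ x) = x :=
  recursion_eqs (F := pred) (fun _ i => i) fun n => ⟨_, by simp [pred, Tm.pred, den]; rfl, by simp⟩

@[simp] theorem pred_zero : pred (0 : M.Obj N0) = 0 := pred_eqs.1

@[simp] theorem pred_succ (x : M.Obj N0) : pred (succ x) = x := pred_eqs.2 x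

theorem eq_zero_or_eq_succ (x : M.Obj N0) : x = 0 ∨ ∃ y, x = succ y := by
  have := induction_or (M := M) (g := fun x => x) (h := fun _ => 0)
    (g' := fun x => x) (h' := fun x => succ (pred x)) (by fun_prop) (by fun_prop) (by fun_prop)
    (by fun_prop) (by simp) (by simp) x
  exact this.imp_right fun h => ⟨_, h⟩

@[fun_prop]
theorem Rep.add {σ : Ty} {g h : M.Obj σ → M.Obj N0} (hg : Rep g) (hh : Rep h) :
    Rep fun x => g x + h x :=
  ((Rep.const _).app hg).app hh

theorem add_eqs (x : M.Obj N0) : x + 0 = x ∧ ∀ y, x + succ y = succ (x + y) :=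
  recursion_eqs (F := fun y => x + y) (fun a _ => succ a) fun n =>
    ⟨_, by simp [← add_def, Tm.add, den]; rfl, by simp [cst_succ]⟩

@[simp] theorem add_zero (x : M.Obj N0) : x + 0 = x := (add_eqs x).1

@[simp] theorem add_succ (x y : M.Obj N0) : x + succ y = succ (x + y) := (add_eqs x).2 y

@[simp] theorem zero_add (x : M.Obj N0) : 0 + x = x := by
  refine induction_eq (g := fun x => 0 + x) (h := fun x => x) (by fun_prop) (by fun_prop) ?_ ?_ x
  · simp
  · intro x hx; simp [hx]

@[simp] theorem succ_add (x y : M.Obj N0) : succ x + y = succ (x + y) := by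
  refine induction_eq (g := fun y => succ x + y) (h := fun y => succ (x + y)) (by fun_prop)
    (by fun_prop) ?_ ?_ y
  · simp
  · intro y hy; simp [hy]

theorem add_comm (x y : M.Obj N0) : x + y = y + x := by
  refine induction_eq (g := fun y => x + y) (h := fun y => y + x) (by fun_prop)
    (by fun_prop) ?_ ?_ y
  · simp
  · intro y hy; simp [hy]

theorem add_assoc (x y z : M.Obj N0) : x + y + z = x + (y + z) := by
  refine induction_eq (g := fun z => x + y + z) (h := fun z => x + (y + z)) (by fun_prop)
    (by fun_prop) ?_ ?_ z
  · simp
  · intro z hz; simp [hz]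

@[fun_prop]
theorem Rep.sub {σ : Ty} {g h : M.Obj σ → M.Obj N0} (hg : Rep g) (hh : Rep h) :
    Rep fun x => g x - h x :=
  ((Rep.const _).app hg).app hh

theorem sub_eqs (x : M.Obj N0) : x - 0 = x ∧ ∀ y, x - succ y = pred (x - y) :=
  recursion_eqs (F := fun y => x - y) (fun a _ => pred a) fun n =>
    ⟨_, by simp [← sub_def, Tm.monus, den]; rfl, by simp [pred]⟩

@[simp] theorem sub_zero (x : M.Obj N0) : x - 0 = x := (sub_eqs x).1

@[simp] theorem sub_succ (x y : M.Obj N0) : x - succ y = pred (x - y) := (sub_eqs x).2 y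

theorem succ_sub_succ (x y : M.Obj N0) : succ x - succ y = x - y := by
  refine induction_eq (g := fun y => succ x - succ y) (h := fun y => x - y) (by fun_prop)
    (by fun_prop) ?_ ?_ y
  · simp
  · intro y hy
    rw [sub_succ, hy, sub_succ]

@[simp] theorem add_sub_cancel_right (x y : M.Obj N0) : x + y - y = x := by
  refine induction_eq (g := fun y => x + y - y) (h := fun _ => x) (by fun_prop)
    (by fun_prop) ?_ ?_ y
  · simp
  · intro y hy
    rw [add_succ, succ_sub_succ, hy]

@[simp] theorem add_sub_cancel_left (x y : M.Obj N0) : x + y - x = y := by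
  rw [add_comm, add_sub_cancel_right]

@[simp] theorem sub_self (x : M.Obj N0) : x - x = 0 := by
  simpa using add_sub_cancel_right 0 x

@[simp] theorem sub_add_self (x y : M.Obj N0) : x - (y + x) = 0 := by
  refine induction_eq (g := fun x => x - (y + x)) (h := fun _ => 0) (by fun_prop)
    (by fun_prop) ?_ ?_ x
  · refine induction_eq (g := fun y => 0 - (y + 0)) (h := fun _ => 0) (by fun_prop)
      (by fun_prop) ?_ ?_ y
    · simp
    · intro y hy
      simp only [add_zero] at hy
      simp [hy]
  · intro x hx
    rw [add_succ, succ_sub_succ, hx]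

/-- Linearity of the order, stated by truncated subtraction so that it is a disjunction of equations
and open to quantifier-free induction. -/
theorem eq_add_sub_or (x y : M.Obj N0) : x = y + (x - y) ∨ y = x + (y - x) := by
  refine induction_or (g := fun _ => x) (h := fun y => y + (x - y)) (g' := fun y => y)
    (h' := fun y => x + (y - x)) (by fun_prop) (by fun_prop) (by fun_prop) (by fun_prop) ?_ ?_ y
  · simp
  · intro y hy
    rcases hy with hy | hy
    · rcases eq_zero_or_eq_succ (x - y) with h | ⟨z, h⟩
      · simp only [h, add_zero] at hy
        subst hy
        have : succ x - x = succ 0 := by simpa using add_sub_cancel_left x (succ 0)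
        simp [this]
      · left
        rw [h] at hy
        simpa [h] using hy
    · right
      have : succ y - x = succ (y - x) := by
        conv_lhs => rw [hy]
        rw [← add_succ, add_sub_cancel_left]
      rw [this, add_succ, ← hy]

@[fun_prop]
theorem Rep.cond {σ : Ty} {f g h : M.Obj σ → M.Obj N0} (hf : Rep f) (hg : Rep g) (hh : Rep h) :
    Rep fun x => cond (f x) (g x) (h x) :=
  (((Rep.const _).app hf).app hg).app hh

@[simp] theorem cond_zero (y z : M.Obj N0) : cond 0 y z = y := by
  simp [← cond_def, Tm.cond, den, recr_zero]

@[simp] theorem cond_succ (x y z : M.Obj N0) : cond (succ x) y z = z := by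
  simp [← cond_def, Tm.cond, den, recr_succ]

theorem cond_of_ne_zero {x : M.Obj N0} (hx : x ≠ 0) (y z : M.Obj N0) : cond x y z = z := by
  obtain ⟨x, rfl⟩ := (eq_zero_or_eq_succ x).resolve_left hx
  exact cond_succ x y z

theorem ne_succ_self (x : M.Obj N0) : x ≠ succ x := fun h => by
  have h' : succ x - x = succ 0 := by simpa using add_sub_cancel_left x (succ 0)
  rw [← h, sub_self] at h'
  exact zero_ne_succ 0 h'

/-! ### Decidable predicates -/

/-- The predicate is given by the zeros of an object of the model. -/
def Dec {σ : Ty} (P : M.Obj σ → Prop) : Prop :=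
  ∃ g : M.Obj σ → M.Obj N0, Rep g ∧ ∀ x, P x ↔ g x = 0

theorem add_eq_zero_iff {x y : M.Obj N0} : x + y = 0 ↔ x = 0 ∧ y = 0 := by
  rcases eq_zero_or_eq_succ x with rfl | ⟨x, rfl⟩
  · simp
  · simp [succ_ne_zero]

theorem Dec.eq {σ : Ty} {g h : M.Obj σ → M.Obj N0} (hg : Rep g) (hh : Rep h) :
    Dec fun x => g x = h x := by
  refine ⟨fun x => (g x - h x) + (h x - g x), by fun_prop, fun x => ⟨fun e => ?_, fun e => ?_⟩⟩
  · simp [e]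
  · obtain ⟨h₁, h₂⟩ := add_eq_zero_iff.1 e
    rcases eq_add_sub_or (g x) (h x) with h | h
    · rwa [h₁, add_zero] at h
    · rw [h₂, add_zero] at h
      exact h.symm

theorem Dec.not {σ : Ty} {P : M.Obj σ → Prop} (hP : Dec P) : Dec fun x => ¬ P x := by
  obtain ⟨g, hg, hP⟩ := hP
  refine ⟨fun x => HOArith.AppStr.cond (g x) (succ 0) 0, by fun_prop, fun x => ?_⟩
  simp only [hP]
  rcases eq_zero_or_eq_succ (g x) with h | ⟨y, h⟩ <;> simp [h, succ_ne_zero]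

theorem Dec.and {σ : Ty} {P Q : M.Obj σ → Prop} (hP : Dec P) (hQ : Dec Q) :
    Dec fun x => P x ∧ Q x := by
  obtain ⟨g, hg, hP⟩ := hP
  obtain ⟨h, hh, hQ⟩ := hQ
  exact ⟨fun x => g x + h x, by fun_prop, fun x => by simp only [hP, hQ, add_eq_zero_iff]⟩

theorem Dec.or {σ : Ty} {P Q : M.Obj σ → Prop} (hP : Dec P) (hQ : Dec Q) :
    Dec fun x => P x ∨ Q x := by
  simpa [or_iff_not_and_not] using (hP.not.and hQ.not).not

/-- Induction for decidable predicates. -/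
theorem Dec.induction {P : M.Obj N0 → Prop} (hP : Dec P) (h₀ : P 0)
    (hs : ∀ x, P x → P (succ x)) (x : M.Obj N0) : P x := by
  obtain ⟨g, hg, hP⟩ := hP
  simp only [hP] at h₀ hs ⊢
  exact induction_eq hg (.const 0) h₀ hs x

/-! ### Pairing and sequences -/

@[fun_prop]
theorem Rep.tri {σ : Ty} {g : M.Obj σ → M.Obj N0} (hg : Rep g) : Rep fun x => tri (g x) :=
  (Rep.const _).app hg

theorem tri_eqs : tri (0 : M.Obj N0) = 0 ∧ ∀ x : M.Obj N0, tri (succ x) = succ (tri x + x) :=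
  recursion_eqs (F := tri) (fun a i => succ (a + i)) fun n =>
    ⟨_, by simp [tri, Tm.tri, den]; rfl, by simp [cst_succ, add_def]⟩

@[simp] theorem tri_zero : tri (0 : M.Obj N0) = 0 := tri_eqs.1

@[simp] theorem tri_succ (x : M.Obj N0) : tri (succ x) = succ (tri x + x) := tri_eqs.2 x

@[fun_prop]
theorem Rep.diag {σ : Ty} {g : M.Obj σ → M.Obj N0} (hg : Rep g) : Rep fun x => diag (g x) :=
  (Rep.const _).app hg

theorem diag_eqs : diag (0 : M.Obj N0) = 0 ∧ ∀ x : M.Obj N0,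
    diag (succ x) = cond (tri (succ (diag x)) - succ x) (succ (diag x)) (diag x) :=
  recursion_eqs (F := diag) (fun a i => cond (tri (succ a) - succ i) (succ a) a) fun n =>
    ⟨_, by simp [diag, Tm.diag, den]; rfl, fun a i => by
      simp only [val_lam, val_app, val_emb, val_var, val_cst, Env.cons_here, Env.cons_there,
        cst_succ, cond_def, sub_def, tri]⟩

@[simp] theorem diag_zero : diag (0 : M.Obj N0) = 0 := diag_eqs.1

theorem diag_succ (x : M.Obj N0) :
    diag (succ x) = cond (tri (succ (diag x)) - succ x) (succ (diag x)) (diag x) :=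
  diag_eqs.2 x

/-- While b ≤ w, the number `tri w + b` has not reached `tri (w + 1)`, so `diag` keeps the value w.
The second alternative says b > w, as an equation expressing that `b - w` is a successor. -/
theorem diag_tri_add_or {w : M.Obj N0} (hw : diag (tri w) = w) (b : M.Obj N0) :
    diag (tri w + b) = w ∨ b - w = succ (pred (b - w)) := by
  refine induction_or (g := fun b => diag (tri w + b)) (h := fun _ => w) (g' := fun b => b - w)
    (h' := fun b => succ (pred (b - w))) (by fun_prop) (by fun_prop) (by fun_prop) (by fun_prop)
    ?_ ?_ b
  · simp [hw]
  · intro b hb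
    rcases eq_add_sub_or b w with h | h
    · right
      have : succ b - w = succ (b - w) := by
        conv_lhs => rw [h]
        rw [← add_succ, add_sub_cancel_left]
      simp [this]
    · rcases hb with hb | hb
      · rw [add_succ, diag_succ, hb, tri_succ, succ_sub_succ]
        have : tri w + w - (tri w + b) = w - b := by
          conv_lhs => rw [h, ← add_assoc, h.symm]
          rw [add_sub_cancel_left]
        rw [this]
        rcases eq_zero_or_eq_succ (w - b) with h' | ⟨z, h'⟩
        · right
          rw [h', add_zero] at h
          subst h
          have : succ w - w = succ 0 := by simpa using add_sub_cancel_left w (succ 0)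
          simp [this]
        · left
          simp [h']
      · rw [h, add_comm, sub_add_self] at hb
        exact absurd hb.symm (succ_ne_zero _)

theorem diag_tri (w : M.Obj N0) : diag (tri w) = w := by
  refine induction_eq (g := fun w => diag (tri w)) (h := fun w => w) (by fun_prop) (by fun_prop)
    ?_ ?_ w
  · simp
  · intro w hw
    -- At `b = w` the value is still w. The next argument is `tri (w + 1)`, where `diag` jumps.
    have := (diag_tri_add_or hw w).resolve_right (by simp)
    simp only [tri_succ]
    rw [diag_succ, this]
    simp

theorem diag_tri_add (a b : M.Obj N0) : diag (tri (a + b) + b) = a + b :=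
  (diag_tri_add_or (diag_tri _) b).resolve_right (by simp)

@[fun_prop]
theorem Rep.pair {σ : Ty} {g h : M.Obj σ → M.Obj N0} (hg : Rep g) (hh : Rep h) :
    Rep fun x => pair (g x) (h x) :=
  ((Rep.const _).app hg).app hh

theorem pair_eq (x y : M.Obj N0) : pair x y = tri (x + y) + y := by
  simp [pair, Tm.pair, den, ← add_def, tri]

@[fun_prop]
theorem Rep.fst {σ : Ty} {g : M.Obj σ → M.Obj N0} (hg : Rep g) : Rep fun x => fst (g x) :=
  (Rep.const _).app hg

@[fun_prop]
theorem Rep.snd {σ : Ty} {g : M.Obj σ → M.Obj N0} (hg : Rep g) : Rep fun x => snd (g x) :=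
  (Rep.const _).app hg

theorem snd_eq (x : M.Obj N0) : snd x = x - tri (diag x) := by
  simp [snd, Tm.snd, den, ← sub_def, tri, diag]

theorem fst_eq (x : M.Obj N0) : fst x = diag x - snd x := by
  simp [fst, Tm.fst, den, ← sub_def, snd, diag]

@[simp] theorem snd_pair (x y : M.Obj N0) : snd (pair x y) = y := by
  rw [snd_eq, pair_eq, diag_tri_add, add_sub_cancel_left]

@[simp] theorem fst_pair (x y : M.Obj N0) : fst (pair x y) = x := by
  rw [fst_eq, snd_pair, pair_eq, diag_tri_add, add_sub_cancel_right]

end Model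

/-! ### Coded sequences and machine runs -/

/-- The sequence without its first entries. -/
def drop (l i : M.Obj N0) : M.Obj N0 := den Tm.drop ⋆ l ⋆ i

/-- An entry of a sequence. -/
def get (l i : M.Obj N0) : M.Obj N0 := den Tm.get ⋆ l ⋆ i

/-- The sequence with one entry changed. -/
def set (l i v : M.Obj N0) : M.Obj N0 := den Tm.set ⋆ l ⋆ i ⋆ v

/-- The code of an initial segment of a function. -/
def bar (f : M.Obj N1) (n : M.Obj N0) : M.Obj N0 := den Tm.bar ⋆ f ⋆ n

/-- The instruction that is due in a configuration. -/
def instr (e c : M.Obj N0) : M.Obj N0 := den Tm.instr ⋆ e ⋆ c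

/-- The effect of an instruction. -/
def exec (A : M.Obj N1) (op m n c : M.Obj N0) : M.Obj N0 := den Tm.exec ⋆ A ⋆ op ⋆ m ⋆ n ⋆ c

/-- The next configuration. -/
def step (A : M.Obj N1) (e c : M.Obj N0) : M.Obj N0 := den Tm.step ⋆ A ⋆ e ⋆ c

/-- The configuration after a number of steps. -/
def run (A : M.Obj N1) (e x s : M.Obj N0) : M.Obj N0 := den Tm.run ⋆ A ⋆ e ⋆ x ⋆ s

/-- The machine has halted within `s` steps. -/
def Halted (A : M.Obj N1) (e x s : M.Obj N0) : Prop := fst (instr e (run A e x s)) = 0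

/-- The content of register `0` after `s` steps. -/
def output (A : M.Obj N1) (e x s : M.Obj N0) : M.Obj N0 := get (snd (run A e x s)) 0

theorem holds_phi {Γ : Ctx} (ν : M.Env Γ) (A : Tm Γ N1) (e x s y : Tm Γ N0) :
    Holds ν (Fm.phi A e x s y) ↔ Halted (val ν A) (val ν e) (val ν x) (val ν s) ∧
      output (val ν A) (val ν e) (val ν x) (val ν s) = val ν y := by
  simp only [Fm.phi, holds_and, holds_eq, val_app, val_emb]
  rfl

section Model
variable [hM : Fact M.IsModel]

@[fun_prop]
theorem Rep.bar {σ : Ty} {f : M.Obj σ → M.Obj N1} {g : M.Obj σ → M.Obj N0} (hf : Rep f)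
    (hg : Rep g) : Rep fun x => bar (f x) (g x) :=
  ((Rep.const _).app hf).app hg

@[fun_prop]
theorem Rep.get {σ : Ty} {g h : M.Obj σ → M.Obj N0} (hg : Rep g) (hh : Rep h) :
    Rep fun x => get (g x) (h x) :=
  ((Rep.const _).app hg).app hh

@[fun_prop]
theorem Rep.instr {σ : Ty} {g h : M.Obj σ → M.Obj N0} (hg : Rep g) (hh : Rep h) :
    Rep fun x => instr (g x) (h x) :=
  ((Rep.const _).app hg).app hh

@[fun_prop]
theorem Rep.run {σ : Ty} (A : M.Obj N1) (e x : M.Obj N0) {g : M.Obj σ → M.Obj N0} (hg : Rep g) :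
    Rep fun s => run A e x (g s) :=
  (Rep.const _).app hg

theorem drop_eqs (l : M.Obj N0) : drop l 0 = l ∧ ∀ i, drop l (succ i) = snd (drop l i) :=
  recursion_eqs (F := drop l) (fun a _ => snd a) fun n =>
    ⟨_, by simp [drop, Tm.drop, den]; rfl, by simp [snd]⟩

@[simp] theorem drop_zero (l : M.Obj N0) : drop l 0 = l := (drop_eqs l).1

@[simp] theorem drop_succ (l i : M.Obj N0) : drop l (succ i) = snd (drop l i) := (drop_eqs l).2 i

theorem get_eq (l i : M.Obj N0) : get l i = fst (drop l i) := by
  simp [get, Tm.get, den, fst, drop]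

-- Only registers 0 and 1 are ever changed by `findPos` in the runs considered, so these two
-- instances of `set` suffice.
@[simp] theorem set_zero (l v : M.Obj N0) : set l 0 v = pair v (snd l) := by
  have h : den Tm.drop ⋆ l ⋆ succ 0 = snd l :=
    (drop_succ l 0).trans (congrArg snd (drop_zero l))
  rw [den] at h
  simp [set, Tm.set, den, recr_zero, cst_succ, pair, h]

@[simp] theorem set_one (l v : M.Obj N0) :
    set l (succ 0) v = pair (fst l) (pair v (snd (snd l))) := by
  have h₁ : den Tm.get ⋆ l ⋆ 0 = fst l :=
    (get_eq l 0).trans (congrArg fst (drop_zero l))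
  have h₂ : den Tm.drop ⋆ l ⋆ succ (succ 0) = snd (snd l) := by
    change drop l (succ (succ 0)) = _
    simp
  have h₃ : den Tm.monus ⋆ (succ 0 : M.Obj N0) ⋆ succ 0 = 0 := sub_self (succ 0)
  rw [den] at h₁ h₂ h₃
  simp [set, Tm.set, den, recr_zero, recr_succ, cst_succ, pair, h₁, h₂, h₃]

theorem bar_eqs (f : M.Obj N1) :
    bar f 0 = 0 ∧ ∀ n, bar f (succ n) = succ (pair (bar f n) (f ⋆ n)) :=
  recursion_eqs (F := bar f) (fun a i => succ (pair a (f ⋆ i))) fun n =>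
    ⟨_, by simp [bar, Tm.bar, den]; rfl, by simp [pair, cst_succ]⟩

@[simp] theorem bar_zero (f : M.Obj N1) : bar f 0 = 0 := (bar_eqs f).1

@[simp] theorem bar_succ (f : M.Obj N1) (n : M.Obj N0) :
    bar f (succ n) = succ (pair (bar f n) (f ⋆ n)) :=
  (bar_eqs f).2 n

/-! ### Oracle machines -/

theorem exec_eq (A : M.Obj N1) (op m n c : M.Obj N0) :
    exec A op m n c = cond op c
      (cond (pred op)
        (pair (succ (fst c)) (set (snd c) m (succ (get (snd c) m))))
        (cond (pred (pred op))
          (cond (get (snd c) m) (pair n (snd c))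
            (pair (succ (fst c)) (set (snd c) m (pred (get (snd c) m)))))
          (pair (succ (fst c)) (set (snd c) n (A ⋆ get (snd c) m))))) := by
  simp only [exec, Tm.exec, den, val_lam, val_app, val_emb, val_var, val_cst, Env.cons_here,
    Env.cons_there, cst_succ]
  rfl

theorem step_eq (A : M.Obj N1) (e c : M.Obj N0) :
    step A e c = exec A (fst (instr e c)) (fst (snd (instr e c))) (snd (snd (instr e c))) c := by
  simp only [step, Tm.step, den, val_lam, val_app, val_emb, val_var, Env.cons_here, Env.cons_there]
  rfl

theorem instr_eq (e c : M.Obj N0) : instr e c = get e (fst c) := by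
  simp [instr, Tm.instr, den, get, fst]

theorem run_eqs (A : M.Obj N1) (e x : M.Obj N0) :
    run A e x 0 = pair 0 (pair x 0) ∧ ∀ s, run A e x (succ s) = step A e (run A e x s) :=
  recursion_eqs (F := run A e x) (fun a _ => step A e a) fun n =>
    ⟨_, by simp [run, Tm.run, den, cst_zero]; rfl, by simp [step]⟩

theorem run_zero (A : M.Obj N1) (e x : M.Obj N0) : run A e x 0 = pair 0 (pair x 0) :=
  (run_eqs A e x).1

theorem run_succ (A : M.Obj N1) (e x s : M.Obj N0) : run A e x (succ s) = step A e (run A e x s) :=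
  (run_eqs A e x).2 s

/-- A halt instruction leaves the configuration unchanged, so it is repeated forever. Hence any two
halting stages have the same output. -/
theorem Halted.run_add {A : M.Obj N1} {e x s : M.Obj N0} (h : Halted A e x s) (k : M.Obj N0) :
    run A e x (s + k) = run A e x s := by
  refine induction_eq (g := fun k => run A e x (s + k)) (h := fun _ => run A e x s) (by fun_prop)
    (by fun_prop) (by simp) (fun k hk => ?_) k
  rw [Halted] at h
  rw [add_succ, run_succ, hk, step_eq, exec_eq, h, cond_zero]

theorem Halted.add {A : M.Obj N1} {e x s : M.Obj N0} (h : Halted A e x s) (k : M.Obj N0) :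
    Halted A e x (s + k) := by
  rwa [Halted, h.run_add]

theorem Halted.output_add {A : M.Obj N1} {e x s : M.Obj N0} (h : Halted A e x s) (k : M.Obj N0) :
    output A e x (s + k) = output A e x s := by
  rw [output, h.run_add, output]

theorem Halted.output_eq {A : M.Obj N1} {e x s t : M.Obj N0} (hs : Halted A e x s)
    (ht : Halted A e x t) : output A e x s = output A e x t := by
  rcases eq_add_sub_or s t with h | h
  · rw [h, ht.output_add]
  · rw [h, hs.output_add]

end Model
end AppStr

/-! ### A machine that searches for a positive oracle value -/

namespace Tm

/-- The program
`0: r₀ := A(r₁)`; `1:` decrease `r₀`, or go to `3` if it is `0`; `2:` halt; `3:` increase `r₁`;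
`4:` go to `0` (as `r₂ = 0`). Its output is the predecessor of the first positive value of `A`. -/
def findPos : Tm [] N0 :=
  let one : Tm [] N0 := S Z
  let two : Tm [] N0 := S one
  let three : Tm [] N0 := S two
  pair ⬝ (pair ⬝ three ⬝ (pair ⬝ one ⬝ Z)) ⬝ (
    pair ⬝ (pair ⬝ two ⬝ (pair ⬝ Z ⬝ three)) ⬝ (
      pair ⬝ (pair ⬝ Z ⬝ Z) ⬝ (
        pair ⬝ (pair ⬝ one ⬝ (pair ⬝ one ⬝ Z)) ⬝ (
          pair ⬝ (pair ⬝ two ⬝ (pair ⬝ two ⬝ Z)) ⬝ Z))))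

/-- `λ c f n.` if `f(n) = 0`, then `c + 1`, else `0`. -/
def probe : Tm [] (N0 ⇾ N1 ⇾ N1) := lam (lam (lam (cond.emb ⬝ (v1 ⬝ v0) ⬝ S v2 ⬝ Z)))

/-- The constant function `0`. -/
def zeroFn : Tm [] N1 := lam Z

/-- `λ f n.` some zero of `f` below `n`, if there is one. -/
def zeroBelow : Tm [] (N1 ⇾ N0 ⇾ N0) :=
  lam (lam (recN v0 Z (lam (lam (cond.emb ⬝ (v3 ⬝ v1) ⬝ v1 ⬝ v0)))))

/-- The functional computing a uniform diagonally nonrecursive function from `μ`. -/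
def udnrOfMu : Tm [] (N2 ⇾ N1 ⇾ N1) :=
  lam (lam (lam (S (get.emb ⬝ (snd.emb ⬝ (run.emb ⬝ v1 ⬝ v0 ⬝ v0 ⬝
    (v2 ⬝ lam (fst.emb ⬝ (instr.emb ⬝ v1 ⬝ (run.emb ⬝ v2 ⬝ v1 ⬝ v1 ⬝ v0)))))) ⬝ Z))))

/-- The functional computing `μ` from a uniform diagonally nonrecursive function and an
extensionality functional for it. -/
def muOfUdnr : Tm [] ((N1 ⇾ N1) ⇾ (N1 ⇾ N1 ⇾ N0 ⇾ N0) ⇾ N2) :=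
  lam (lam (lam (zeroBelow.emb ⬝ v0 ⬝
    (v1 ⬝ (probe.emb ⬝ (v2 ⬝ zeroFn.emb ⬝ findPos.emb) ⬝ v0) ⬝ zeroFn.emb ⬝ S findPos.emb))))

end Tm

namespace AppStr
variable {M : AppStr}

/-! ### The principles in a model -/

/-- `Ψ` yields uniform diagonally nonrecursive functions. -/
def IsUDNR (Ψ : M.Obj (N1 ⇾ N1)) : Prop :=
  ∀ A e, ¬ ∃ s, Halted A e e s ∧ output A e e s = Ψ ⋆ A ⋆ e

/-- `μ` is an unbounded search operator. -/
def IsMu (μ : M.Obj N2) : Prop := ∀ f : M.Obj N1, (∃ n, f ⋆ n = 0) → f ⋆ (μ ⋆ f) = 0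

theorem holds_UDNRof {Γ : Ctx} (ν : M.Env Γ) (Ψ : Tm Γ (N1 ⇾ N1)) :
    Holds ν (Fm.UDNRof Ψ) ↔ IsUDNR (val ν Ψ) := by
  simp [Fm.UDNRof, holds_phi, IsUDNR]

theorem holds_MUof {Γ : Ctx} (ν : M.Env Γ) (μ : Tm Γ N2) :
    Holds ν (Fm.MUof μ) ↔ IsMu (val ν μ) := by
  simp [Fm.MUof, IsMu, cst_zero]

theorem holds_muSq_iff : Holds (M := M) Env.nil Fm.muSq ↔ ∃ μ : M.Obj N2, IsMu μ := by
  simp only [Fm.muSq, holds_ex, holds_MUof, val_var, Env.cons_here]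

variable [hM : Fact M.IsModel]

/-- Configurations are displayed as program counter, r₀, r₁ and remaining registers t. The condition
`fst t = 0` says r₂ = 0, which makes the last instruction an unconditional jump. -/
theorem step_findPos (A : M.Obj N1) (a b t : M.Obj N0) :
    let e : M.Obj N0 := den Tm.findPos
    step A e (pair 0 (pair a (pair b t))) = pair (succ 0) (pair (A ⋆ b) (pair b t)) ∧
    step A e (pair (succ 0) (pair 0 (pair b t))) =
      pair (succ (succ (succ 0))) (pair 0 (pair b t)) ∧
    step A e (pair (succ 0) (pair (succ a) (pair b t))) =
      pair (succ (succ 0)) (pair a (pair b t)) ∧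
    fst (instr e (pair (succ (succ 0)) t)) = 0 ∧
    step A e (pair (succ (succ (succ 0))) (pair a (pair b t))) =
      pair (succ (succ (succ (succ 0)))) (pair a (pair (succ b) t)) ∧
    (fst t = 0 → step A e (pair (succ (succ (succ (succ 0)))) (pair a (pair b t))) =
      pair 0 (pair a (pair b t))) := by
  have he : (den Tm.findPos : M.Obj N0) =
      pair (pair (succ (succ (succ 0))) (pair (succ 0) 0)) (
        pair (pair (succ (succ 0)) (pair 0 (succ (succ (succ 0))))) (
          pair (pair 0 0) (
            pair (pair (succ 0) (pair (succ 0) 0)) (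
              pair (pair (succ (succ 0)) (pair (succ (succ 0)) 0)) 0)))) := rfl
  simp +contextual [step_eq, exec_eq, instr_eq, get_eq, he]

theorem Halted.of_findPos {A : M.Obj N1} {x s a i t c : M.Obj N0}
    (h : run A (den Tm.findPos) x s = pair 0 (pair a (pair i t))) (hi : A ⋆ i = succ c) :
    Halted A (den Tm.findPos) x (succ (succ s)) ∧
      output A (den Tm.findPos) x (succ (succ s)) = c := by
  have h₀ := (step_findPos A a i t).1
  have h₁ := (step_findPos A c i t).2.2.1
  have hr : run A (den Tm.findPos) x (succ (succ s)) = pair (succ (succ 0)) (pair c (pair i t)) := by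
    rw [run_succ, run_succ, h, h₀, hi, h₁]
  refine ⟨?_, by simp [output, hr, get_eq]⟩
  rw [Halted, hr]
  exact (step_findPos A 0 0 _).2.2.2.1

theorem run_findPos {A : M.Obj N1} {x s a i t : M.Obj N0}
    (h : run A (den Tm.findPos) x s = pair 0 (pair a (pair i t))) (ht : fst t = 0)
    (hi : A ⋆ i = 0) :
    run A (den Tm.findPos) x (succ (succ (succ (succ s)))) =
      pair 0 (pair 0 (pair (succ i) t)) := by
  rw [run_succ, run_succ, run_succ, run_succ, h, (step_findPos A a i t).1, hi,
    (step_findPos A a i t).2.1, (step_findPos A 0 i t).2.2.2.2.1,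
    (step_findPos A 0 (succ i) t).2.2.2.2.2 ht]

/-- Every positive oracle value is `c + 1`, so it does not matter which one the search meets, and no
least-number principle is needed. -/
theorem exists_halted_findPos {A : M.Obj N1} {c m : M.Obj N0}
    (hA : ∀ n, A ⋆ n = 0 ∨ A ⋆ n = succ c) (hm : A ⋆ m ≠ 0) (x : M.Obj N0) :
    ∃ s, Halted A (den Tm.findPos) x s ∧ output A (den Tm.findPos) x s = c := by
  set e : M.Obj N0 := den Tm.findPos with he
  obtain ⟨r, hr⟩ : Rep fun i => run A e x (i + i + (i + i)) := by fun_prop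
  -- Invariant at stage 4i, one unsuccessful round being four steps: either the machine has halted
  -- with output c, or it is back at instruction 0 with r₁ = i and r₂ = 0. The unknown registers are
  -- read off by projections instead of being quantified, which keeps the invariant decidable.
  have key : ∀ i, (fst (instr e (r ⋆ i)) = 0 ∧ get (snd (r ⋆ i)) 0 = c) ∨
      (r ⋆ i = pair 0 (pair (fst (snd (r ⋆ i))) (pair i (snd (snd (snd (r ⋆ i)))))) ∧
        fst (snd (snd (snd (r ⋆ i)))) = 0) := by
    refine Dec.induction (.or (.and (.eq (by fun_prop) (by fun_prop)) (.eq (by fun_prop)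
      (by fun_prop))) (.and (.eq (by fun_prop) (by fun_prop)) (.eq (by fun_prop) (by fun_prop))))
      ?_ ?_
    · have h₀ : pair (0 : M.Obj N0) 0 = 0 := by simp [pair_eq]
      have h₁ : fst (0 : M.Obj N0) = 0 := (congrArg fst h₀).symm.trans (fst_pair 0 0)
      have h₂ : snd (0 : M.Obj N0) = 0 := (congrArg snd h₀).symm.trans (snd_pair 0 0)
      right
      simp [hr, run_zero, h₀, h₁, h₂]
    · intro i hi
      have h₄ : succ i + succ i + (succ i + succ i) = succ (succ (succ (succ (i + i + (i + i))))) := by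
        simp
      -- A machine that has already halted idles for the four steps. One that finds a positive value
      -- halts after two and idles for the other two.
      have h₄' (s : M.Obj N0) : succ (succ (succ (succ s))) = s + succ (succ (succ (succ 0))) := by
        simp
      have h₂' (s : M.Obj N0) : succ (succ (succ (succ s))) = succ (succ s) + succ (succ 0) := by
        simp
      simp only [hr] at hi ⊢
      rw [h₄]
      rcases hi with ⟨h, h'⟩ | ⟨h, h'⟩
      · left
        rw [h₄']
        exact ⟨Halted.add h _, (Halted.output_add h _).trans h'⟩
      · rcases hA i with hi | hi
        · right
          have := run_findPos h h' hi
          rw [this]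
          simpa using h'
        · left
          obtain ⟨h₁, h₂⟩ := Halted.of_findPos h hi
          rw [h₂']
          exact ⟨Halted.add h₁ _, (Halted.output_add h₁ _).trans h₂⟩
  have hm' := key m
  simp only [hr] at hm'
  rcases hm' with h | ⟨h, -⟩
  · exact ⟨_, h⟩
  · exact ⟨_, Halted.of_findPos h ((hA m).resolve_left hm)⟩

theorem IsMu.isUDNR {μ : M.Obj N2} (h : IsMu μ) : IsUDNR (den Tm.udnrOfMu ⋆ μ) := by
  rintro A e ⟨s, hs, ho⟩
  obtain ⟨f, hf⟩ : Rep fun s => fst (instr e (run A e e s)) := by fun_prop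
  have hΨ : den Tm.udnrOfMu ⋆ μ ⋆ A ⋆ e = succ (output A e e (μ ⋆ f)) := by
    rw [den, Tm.udnrOfMu, val_lam, val_lam, val_lam]
    simp only [val_app, val_emb, val_var, val_cst, Env.cons_here, Env.cons_there, cst_succ]
    -- The abstraction inside `udnrOfMu` and `f` agree pointwise, so `μ` takes the same value on
    -- both.
    rw [M.ext (val _ _) f fun s => ?_]
    · rfl
    · rw [hf]
      simp [fst, instr, run]
  have hμ : f ⋆ (μ ⋆ f) = 0 := h f ⟨s, (hf s).trans hs⟩
  rw [hf] at hμ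
  rw [hΨ, hs.output_eq hμ] at ho
  exact ne_succ_self _ ho

/-! ### From uniform diagonal nonrecursiveness to unbounded search -/

@[simp] theorem zeroFn_app (n : M.Obj N0) : den Tm.zeroFn ⋆ n = 0 := by
  simp [Tm.zeroFn, den, cst_zero]

@[simp] theorem probe_app (c : M.Obj N0) (f : M.Obj N1) (n : M.Obj N0) :
    den Tm.probe ⋆ c ⋆ f ⋆ n = cond (f ⋆ n) (succ c) 0 := by
  rw [den, Tm.probe, val_lam, val_lam, val_lam]
  simp [cond, cst_zero, cst_succ]

theorem IsUDNR.probe_ne {Ψ : M.Obj (N1 ⇾ N1)} (h : IsUDNR Ψ) (c : M.Obj N0) {f : M.Obj N1}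
    (hf : ∃ n, f ⋆ n = 0) : Ψ ⋆ (den Tm.probe ⋆ c ⋆ f) ⋆ den Tm.findPos ≠ c := by
  obtain ⟨m, hm⟩ := hf
  obtain ⟨s, hs, ho⟩ := exists_halted_findPos (A := den Tm.probe ⋆ c ⋆ f) (c := c) (m := m)
    (fun n => by rcases eq_zero_or_eq_succ (f ⋆ n) with h | ⟨k, h⟩ <;> simp [h]) (by simp [hm])
    (den Tm.findPos)
  exact fun hc => h _ _ ⟨s, hs, ho.trans hc.symm⟩

/-- The discontinuity of Ψ at the zero oracle tests for zeros of f, and quantifier-free choice then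
selects a zero. -/
theorem IsUDNR.exists_isMu {Ψ : M.Obj (N1 ⇾ N1)} (h : IsUDNR Ψ) : ∃ μ : M.Obj N2, IsMu μ := by
  set c : M.Obj N0 := Ψ ⋆ den Tm.zeroFn ⋆ den Tm.findPos with hc
  obtain ⟨b, hb⟩ : Rep fun f : M.Obj N1 => Ψ ⋆ (den Tm.probe ⋆ c ⋆ f) ⋆ den Tm.findPos := by
    fun_prop
  obtain ⟨μ, hμ⟩ := exists_choice b c fun f hf => by
    by_contra hn
    push Not at hn
    refine hf ?_
    simp only [hb]
    -- Without a zero of f the probe vanishes everywhere. Extensionality then gives Ψ the same value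
    -- on it as on the zero oracle.
    rw [M.ext (den Tm.probe ⋆ c ⋆ f) (den Tm.zeroFn) fun n => by simp [cond_of_ne_zero (hn n)], hc]
  exact ⟨μ, fun f hf => hμ f (by simpa only [hb] using h.probe_ne c hf)⟩

/-- The recursion carries a candidate: it is kept once it is a zero of f, and otherwise replaced by
the current index. -/
theorem zeroBelow_eqs (f : M.Obj N1) : den Tm.zeroBelow ⋆ f ⋆ 0 = 0 ∧
    ∀ n, den Tm.zeroBelow ⋆ f ⋆ succ n =
      cond (f ⋆ (den Tm.zeroBelow ⋆ f ⋆ n)) (den Tm.zeroBelow ⋆ f ⋆ n) n :=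
  recursion_eqs (F := fun n => den Tm.zeroBelow ⋆ f ⋆ n) (fun a i => cond (f ⋆ a) a i) fun n =>
    ⟨_, by simp [Tm.zeroBelow, den, cst_zero]; rfl, by simp [cond]⟩

theorem IsUDNR.isMu {Ψ : M.Obj (N1 ⇾ N1)} {Ξ : M.Obj (N1 ⇾ N1 ⇾ N0 ⇾ N0)} (h : IsUDNR Ψ)
    (hΞ : ∀ k f g, bar f (Ξ ⋆ f ⋆ g ⋆ k) = bar g (Ξ ⋆ f ⋆ g ⋆ k) →
      bar (Ψ ⋆ f) k = bar (Ψ ⋆ g) k) :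
    IsMu (den Tm.muOfUdnr ⋆ Ψ ⋆ Ξ) := by
  intro f hf
  set c : M.Obj N0 := Ψ ⋆ den Tm.zeroFn ⋆ den Tm.findPos with hc
  have hu : den Tm.muOfUdnr ⋆ Ψ ⋆ Ξ ⋆ f = den Tm.zeroBelow ⋆ f ⋆
      (Ξ ⋆ (den Tm.probe ⋆ c ⋆ f) ⋆ den Tm.zeroFn ⋆ succ (den Tm.findPos)) := by
    rw [den, Tm.muOfUdnr, val_lam, val_lam, val_lam]
    simp only [val_app, val_emb, val_var, val_cst, Env.cons_here, Env.cons_there, cst_succ]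
    rfl
  rw [hu]
  -- Either the bounded search below n has succeeded, or f has no zero below n and the probe agrees
  -- there with the zero oracle.
  have key (n : M.Obj N0) : f ⋆ (den Tm.zeroBelow ⋆ f ⋆ n) = 0 ∨
      bar (den Tm.probe ⋆ c ⋆ f) n = bar (den Tm.zeroFn) n := by
    refine induction_or (g := fun n => f ⋆ (den Tm.zeroBelow ⋆ f ⋆ n)) (h := fun _ => 0)
      (g' := bar (den Tm.probe ⋆ c ⋆ f)) (h' := bar (den Tm.zeroFn)) (by fun_prop) (by fun_prop)
      (by fun_prop) (by fun_prop) (by simp) (fun n hn => ?_) n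
    rw [(zeroBelow_eqs f).2]
    by_cases h₁ : f ⋆ (den Tm.zeroBelow ⋆ f ⋆ n) = 0
    · simp [h₁]
    · rw [cond_of_ne_zero h₁, bar_succ, bar_succ, hn.resolve_left h₁]
      by_cases h₂ : f ⋆ n = 0
      · exact Or.inl h₂
      · simp [cond_of_ne_zero h₂]
  refine (key _).resolve_right fun hb => h.probe_ne c hf ?_
  -- The segments have length `findPos + 1`, so their last entries are the values of Ψ at `findPos`
  -- itself.
  have := succ_inj (by simpa only [bar_succ] using hΞ _ _ _ hb)
  simpa using congrArg snd this

theorem holds_existsSq_iff : Holds (M := M) Env.nil Fm.existsSq ↔ ∃ μ : M.Obj N2, IsMu μ := by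
  simp only [Fm.existsSq, holds_ex, holds_all, holds_iff, holds_eq, val_app, val_var, val_cst,
    Env.cons_here, Env.cons_there, cst_zero]
  constructor
  · rintro ⟨φ, hφ⟩
    -- The test is inverted because `exists_choice` expects a value different from the given
    -- constant, here 0, exactly when a zero exists.
    obtain ⟨b, hb⟩ : Rep fun f : M.Obj N1 => cond (φ ⋆ f) (succ 0) 0 := by fun_prop
    obtain ⟨μ, hμ⟩ := exists_choice b 0 fun f hf => by
      refine (hφ f).2 ?_
      by_contra hn
      exact hf ((hb f).trans (cond_of_ne_zero hn _ _))
    refine ⟨μ, fun f hf => hμ f ?_⟩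
    simp [hb, (hφ f).1 hf]
  · rintro ⟨μ, hμ⟩
    obtain ⟨φ, hφ⟩ : Rep fun f : M.Obj N1 => f ⋆ (μ ⋆ f) := by fun_prop
    exact ⟨φ, fun f => by rw [hφ]; exact ⟨hμ f, fun h => ⟨_, h⟩⟩⟩

theorem holds_UDNR_iff : Holds (M := M) Env.nil Fm.UDNR ↔ ∃ μ : M.Obj N2, IsMu μ := by
  simp only [Fm.UDNR, holds_ex, holds_UDNRof, val_var, Env.cons_here]
  exact ⟨fun ⟨Ψ, hΨ⟩ => hΨ.exists_isMu, fun ⟨μ, hμ⟩ => ⟨_, hμ.isUDNR⟩⟩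

end AppStr
end HOArith

/-! ### The equivalences, by completeness -/

open HOArith
theorem mainTheorem1 :
    RCAProves (Fm.iff Fm.UDNR Fm.muSq) ∧
    RCAProves (Fm.iff Fm.UDNR Fm.existsSq) ∧
    ∃ (s : Tm [] (N2 ⇾ N1 ⇾ N1)) (u : Tm [] ((N1 ⇾ N1) ⇾ (N1 ⇾ N1 ⇾ N0 ⇾ N0) ⇾ N2)),
      RCAProves (.all N2 (.imp (Fm.MUof v0) (Fm.UDNRof (s.emb ⬝ v0)))) ∧
      RCAProves (.all (N1 ⇾ N1) (.all (N1 ⇾ N1 ⇾ N0 ⇾ N0)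
        (.imp (Fm.and (Fm.UDNRof v1) (Fm.ExtFunctional v0 v1))
          (Fm.MUof (u.emb ⬝ v1 ⬝ v0))))) := by
  refine ⟨.of_forall_model fun M hM => ?_, .of_forall_model fun M hM => ?_, Tm.udnrOfMu,
    Tm.muOfUdnr, .of_forall_model fun M hM => ?_, .of_forall_model fun M hM => ?_⟩ <;>
    have : Fact M.IsModel := ⟨hM⟩
  · rw [AppStr.holds_iff, AppStr.holds_UDNR_iff, AppStr.holds_muSq_iff]
  · rw [AppStr.holds_iff, AppStr.holds_UDNR_iff, AppStr.holds_existsSq_iff]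
  · intro μ hμ
    rw [AppStr.holds_MUof] at hμ
    rw [AppStr.holds_UDNRof, AppStr.val_app, AppStr.val_emb]
    exact hμ.isUDNR
  · intro Ψ Ξ h
    rw [AppStr.holds_and, AppStr.holds_UDNRof] at h
    rw [AppStr.holds_MUof, AppStr.val_app, AppStr.val_app, AppStr.val_emb]
    refine h.1.isMu fun k f g hb => ?_
    have := h.2 k f g
    simp only [AppStr.holds_imp, AppStr.holds_eq, AppStr.val_app, AppStr.val_emb, AppStr.val_wk,
      AppStr.val_var, AppStr.Env.cons_here, AppStr.Env.cons_there] at this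
    exact this hb
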